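/- Let $\mathbb{K}$ be a field and let $G$ be a finite simple graph with vertex set $V(G)=\{x_1,\dots,x_n\}$, $n\ge 1$. Let $S=\mathbb{K}[x_1,\dots,x_n]$ with its standard grading, and let $$J(G)=\Big(\prod_{x_i\in C}x_i \;\Big|\; C\text{ is a minimal vertex cover of }G\Big)\subseteq S$$ be the cover ideal of $G$. For an ideal $I$ of $S$ and an integer $k\ge1$, let $I^{(k)}=\bigcap_{\mathfrak p}\operatorname{Ker}\big(S\to (S/I^k)_{\mathfrak p}\big)$ be its $k$-th symbolic power, where $\mathfrak p$ runs over the minimal primes of $I$ (so that $I^{(k)}=S$ if $I=S$). For a monomial ideal $I$, let $\deg(I)$ be the maximum degree of the minimal monomial generators of $I$, and for a nonzero homogeneous ideal $I$ let $\operatorname{reg}(I)=\max\{j-i\mid \beta_{i,j}(I)\ne0\}$ be its Castelnuovo--Mumford regularity, where $\beta_{i,j}(I)$ is the number of summands $S(-j)$ in homological degree $i$ of the minimal graded free resolution $\cdots\to\bigoplus_jS(-j)^{\beta_{1,j}(I)}\to\bigoplus_jS(-j)^{\beta_{0,j}(I)}\to I\to0$ of $I$. Suppose that $G$ is unmixed,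 i.e. that all minimal vertex covers of $G$ have the same cardinality. Then for every integer $k\ge1$, $$k\deg(J(G))\le \operatorname{reg}\big(J(G)^{(k)}\big)\le (k-1)\deg(J(G))+|V(G)|-1.$$ -/

import Mathlib

open MvPolynomial

universe u v

/-- A polynomial all of whose monomials have (standard, total) degree `e`, where `e` may be any
integer. The zero polynomial qualifies for every `e`. -/
def IsFormOfDegree {σ : Type u} {K : Type v} [Field K] (p : MvPolynomial σ K) (e : ℤ) : Prop :=
  ∀ m ∈ p.support, (m.degree : ℤ) = e

/-- A graded free resolution
`⋯ ⟶ F 2 ⟶ F 1 ⟶ F 0 ⟶ I ⟶ 0`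
of an ideal `I` of the standard graded polynomial ring `S = K[x_s : s ∈ σ]` by finitely generated
graded free modules `F i = ⨁_b S(-shift i b)`. The `b`-th standard basis vector of `F i` has degree
`shift i b`, and all maps are homogeneous of degree zero. -/
structure GradedFreeResolution {σ : Type u} {K : Type v} [Field K]
    (I : Ideal (MvPolynomial σ K)) where
  /-- the rank of the `i`-th free module -/
  rank : ℕ → ℕ
  /-- the degrees of the basis elements of the `i`-th free module -/
  shift : (i : ℕ) → Fin (rank i) → ℤ
  /-- the augmentation `F 0 ⟶ S`, whose image is `I` -/
  aug : (Fin (rank 0) → MvPolynomial σ K) →ₗ[MvPolynomial σ K] MvPolynomial σ K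
  /-- the differential `F (i + 1) ⟶ F i` -/
  d : (i : ℕ) → (Fin (rank (i + 1)) → MvPolynomial σ K) →ₗ[MvPolynomial σ K]
    (Fin (rank i) → MvPolynomial σ K)
  aug_homogeneous : ∀ b, IsFormOfDegree (aug (Pi.single b 1)) (shift 0 b)
  d_homogeneous : ∀ i b a,
    IsFormOfDegree (d i (Pi.single b 1) a) (shift (i + 1) b - shift i a)
  range_aug : LinearMap.range aug = I
  exact_zero : LinearMap.range (d 0) = LinearMap.ker aug
  exact_succ : ∀ i, LinearMap.range (d (i + 1)) = LinearMap.ker (d i)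

namespace GradedFreeResolution

variable {σ : Type u} {K : Type v} [Field K] {I : Ideal (MvPolynomial σ K)}

/-- A graded free resolution is minimal if every differential `F (i + 1) ⟶ F i` has image in
`𝔪 F i`, where `𝔪` is the ideal generated by the variables; that is, the entries of its matrix have
zero constant term. -/
def IsMinimal (F : GradedFreeResolution I) : Prop :=
  ∀ i b a, constantCoeff (F.d i (Pi.single b 1) a) = 0

/-- The number `β_{i,j}` of copies of `S(-j)` in the `i`-th module of the resolution. -/
noncomputable def betti (F : GradedFreeResolution I) (i : ℕ) (j : ℤ) : ℕ :=
  Nat.card {b : Fin (F.rank i) // F.shift i b = j}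

/-- The set `{j - i | β_{i,j} ≠ 0}`. -/
def regSet (F : GradedFreeResolution I) : Set ℤ :=
  {r | ∃ (i : ℕ) (j : ℤ), F.betti i j ≠ 0 ∧ r = j - i}

end GradedFreeResolution

/-- `HasRegularity I r` says that `I` has a minimal graded free resolution and that
`r = max {j - i | β_{i,j}(I) ≠ 0}`, the graded Betti numbers being read off from any minimal graded
free resolution of `I`. The maximum is required to exist. -/
def HasRegularity {σ : Type u} {K : Type v} [Field K] (I : Ideal (MvPolynomial σ K)) (r : ℤ) :
    Prop :=
  (∃ F : GradedFreeResolution I, F.IsMinimal) ∧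
    ∀ F : GradedFreeResolution I, F.IsMinimal → IsGreatest F.regSet r

/-- The `k`-th symbolic power of an ideal `I`: the intersection, over the minimal primes `𝔭` of
`I`, of the kernels of `R ⟶ (R / I ^ k)_𝔭`. -/
noncomputable def symbolicPower {R : Type u} [CommRing R] (I : Ideal R) (k : ℕ) : Ideal R :=
  ⨅ 𝔭 : I.minimalPrimes,
    haveI : 𝔭.1.IsPrime := 𝔭.2.1.1
    LinearMap.ker
      ((LocalizedModule.mkLinearMap 𝔭.1.primeCompl (R ⧸ I ^ k)).comp (Submodule.mkQ (I ^ k)))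

/-- The set `G(I)` of (exponent vectors of) minimal monomial generators of a monomial ideal `I`:
the monomials in `I` that are minimal with respect to divisibility. -/
def minimalMonomials {σ : Type u} {K : Type v} [Field K] (I : Ideal (MvPolynomial σ K)) :
    Set (σ →₀ ℕ) :=
  {m | Minimal (fun m' : σ →₀ ℕ => monomial m' (1 : K) ∈ I) m}

/-- By Dickson's lemma the set of minimal monomial generators is finite (so the maximum in the
definition of `idealDeg` is attained as soon as `I` contains a monomial). -/
theorem minimalMonomials_finite {σ : Type u} [Finite σ] {K : Type v} [Field K]
    (I : Ideal (MvPolynomial σ K)) : (minimalMonomials I).Finite :=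
  (setOfPred_minimal_antichain _).finite_of_partiallyWellOrderedOn
    (Set.isPWO_of_wellQuasiOrderedLE _)

/-- The degree of a monomial ideal: the maximum degree of its minimal monomial generators. -/
noncomputable def idealDeg {σ : Type u} {K : Type v} [Field K] (I : Ideal (MvPolynomial σ K)) :
    ℕ :=
  sSup (Finsupp.degree '' minimalMonomials I)

namespace SimpleGraph

/-- `C` is a minimal vertex cover of `G`: a vertex cover no proper subset of which is a vertex
cover. -/
def IsMinimalVertexCover {V : Type u} (G : SimpleGraph V) (C : Finset V) : Prop :=
  Minimal (fun D : Finset V => G.IsVertexCover (D : Set V)) C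

/-- `G` is unmixed: all its minimal vertex covers have the same cardinality. -/
def IsUnmixed {V : Type u} (G : SimpleGraph V) : Prop :=
  ∀ C D : Finset V, G.IsMinimalVertexCover C → G.IsMinimalVertexCover D → C.card = D.card

/-- The cover ideal `J(G)`, generated by the monomials `∏_{x ∈ C} x`, where `C` runs over the
minimal vertex covers of `G`. -/
noncomputable def coverIdeal {V : Type u} (G : SimpleGraph V) (K : Type v) [Field K] :
    Ideal (MvPolynomial V K) :=
  Ideal.span {p | ∃ C : Finset V, G.IsMinimalVertexCover C ∧ p = ∏ x ∈ C, X x}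

end SimpleGraph

/-! The Koszul complex on the variables detects graded Betti numbers: β_{i,e}(I) ≠ 0 exactly when
the i-th Koszul homology of I is nonzero in degree e
(`GradedFreeResolution.IsMinimal.betti_ne_zero_iff`). The ideal J(G)^(k) is spanned by the monomials
whose exponents weigh at least k along every edge (`SimpleGraph.mem_symbolicPower_coverIdeal`), so
its Koszul homology splits by multidegree b, and it vanishes at b as soon as some variable is a cone
vertex there (`exists_koszulBdry_eq_of_cone`).

If there is no cone vertex, every x with b x ≥ 1 lies on an edge whose weight drops to exactly k
after a squarefree vector avoiding x is subtracted from b. This makes b a critical cover. Let n =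
|V|, let d be the common size of the minimal covers and A(t) = #{b ≥ t}, so that |b| = ∑ A(t) over 1
≤ t ≤ k. Exchange arguments on independent sets, whose maximal members all have n - d elements, give
A(t) + A(k + 2 - t) ≤ 2d for 2 ≤ t ≤ k. Averaging over these pairs yields |b| ≤ (k - 1)d + A(1) ≤ (k
- 1)d + n. Subtracting i ≥ 1 gives the upper bound; for i = 0 the missing unit comes from
`SimpleGraph.sum_lt_of_tight`.

For the lower bound, the k-th power of the monomial of a minimal cover is a minimal generator of
J(G)^(k), of degree kd. -/

open Classical in
/-- The open neighbourhood of a set of vertices. -/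
noncomputable def SimpleGraph.nbhd {V : Type u} [Fintype V] (G : SimpleGraph V) (A : Finset V) :
    Finset V :=
  Finset.univ.filter fun v => ∃ a ∈ A, G.Adj a v

/-- Every vertex of positive weight in the `k`-cover `b` lies on an edge of weight `k`, or on an
edge of weight `k + 1` whose other end has positive weight and lies on no edge of weight `k`. -/
def SimpleGraph.IsCriticalCover {V : Type u} (G : SimpleGraph V) (k : ℕ) (b : V → ℕ) : Prop :=
  (∀ x y, G.Adj x y → k ≤ b x + b y) ∧ ∀ x, 1 ≤ b x → ∃ y, G.Adj x y ∧ (b x + b y = k ∨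
    b x + b y = k + 1 ∧ 1 ≤ b y ∧ ∀ z, G.Adj y z → k + 1 ≤ b y + b z)

theorem SimpleGraph.IsCriticalCover.le {V : Type u} {G : SimpleGraph V} {k : ℕ} {b : V → ℕ} (hb : G.IsCriticalCover k b) (x : V) :
    b x ≤ k := by
  by_cases h : 1 ≤ b x
  · obtain ⟨y, -, h | h⟩ := hb.2 x h <;> omega
  · omega

/-! ### Critical covers of unmixed graphs and their total weight. -/

section Combinatorics

variable {V : Type u} [Fintype V] {G : SimpleGraph V}

theorem SimpleGraph.mem_nbhd {A : Finset V} {v : V} : v ∈ G.nbhd A ↔ ∃ a ∈ A, G.Adj a v := by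
  simp [SimpleGraph.nbhd]

/-- `A` contains no edge of `G`. -/
def SimpleGraph.Indep (G : SimpleGraph V) (A : Finset V) : Prop :=
  ∀ x ∈ A, ∀ y ∈ A, ¬ G.Adj x y

-- Exchange: extend B to a maximal independent set M. The vertices of M outside B avoid the closed
-- neighbourhood of B, hence that of A, so A can replace B in M without losing independence; the
-- result has at most a elements.
open Classical in
theorem SimpleGraph.Indep.card_le_of_closedNbhd_subset {a : ℕ}
    (hα : ∀ M : Finset V, Maximal G.Indep M → M.card = a)
    {A B : Finset V} (hA : G.Indep A) (hB : G.Indep B)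
    (h : ∀ x, (x ∈ A ∨ x ∈ G.nbhd A) → (x ∈ B ∨ x ∈ G.nbhd B)) : A.card ≤ B.card := by
  obtain ⟨M, hBM, hM⟩ := exists_maximal_ge_of_wellFoundedGT G.Indep B hB
  have key : ∀ z ∈ M \ B, ∀ x ∈ A, ¬ G.Adj x z ∧ z ≠ x := by
    intro z hz x hx
    rw [Finset.mem_sdiff] at hz
    have h3 : ¬ (z ∈ A ∨ z ∈ G.nbhd A) := by
      intro h1
      rcases h z h1 with h2 | h2
      · exact hz.2 h2
      · obtain ⟨b, hb, hbz⟩ := SimpleGraph.mem_nbhd.1 h2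
        exact hM.1 b (hBM hb) z hz.1 hbz
    push Not at h3
    refine ⟨fun hxz => h3.2 (SimpleGraph.mem_nbhd.2 ⟨x, hx, hxz⟩), ?_⟩
    rintro rfl
    exact h3.1 hx
  have hI : G.Indep (A ∪ (M \ B)) := by
    intro x hx y hy
    rw [Finset.mem_union] at hx hy
    rcases hx with hx | hx <;> rcases hy with hy | hy
    · exact hA x hx y hy
    · exact (key y hy x hx).1
    · exact fun e => (key x hx y hy).1 e.symm
    · exact hM.1 x (Finset.mem_sdiff.1 hx).1 y (Finset.mem_sdiff.1 hy).1
  obtain ⟨M', hM1, hM'⟩ := exists_maximal_ge_of_wellFoundedGT G.Indep _ hI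
  have hdisj : Disjoint A (M \ B) := by
    rw [Finset.disjoint_left]
    intro x hx hx'
    exact (key x hx' x hx).2 rfl
  have h1 := Finset.card_le_card hM1
  rw [Finset.card_union_of_disjoint hdisj, hα _ hM'] at h1
  have h2 := Finset.card_sdiff_add_card_eq_card hBM
  rw [hα _ hM] at h2
  omega

open Classical in
/-- In an unmixed graph, an independent set is no larger than its neighbourhood, relative to the
closed neighbourhood of a further independent set. -/
theorem SimpleGraph.Indep.card_le_card_nbhd_sdiff {a : ℕ}
    (hα : ∀ M : Finset V, Maximal G.Indep M → M.card = a) (D : Finset V) (T : Finset V)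
    (hDT : Disjoint D T) (hI : G.Indep (D ∪ T)) (hT : ∀ t ∈ T, ∃ y, G.Adj t y ∧ y ∉ G.nbhd D) :
    T.card ≤ (G.nbhd T \ G.nbhd D).card := by
  induction hn : T.card using Nat.strong_induction_on generalizing T with
  | _ n ih =>
  subst hn
  rcases T.eq_empty_or_nonempty with rfl | ⟨t, ht⟩
  · simp
  -- Induction on |T|: the neighbours of y in T are split off as T₁ and traded for an independent
  -- set Y ∋ y with |T₁| ≤ |Y| that is disjoint from the neighbourhood of the remainder T₂.
  obtain ⟨y, hty, hyD⟩ := hT t ht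
  set T₁ := T.filter fun x => G.Adj y x
  set T₂ := T.filter fun x => ¬ G.Adj y x
  have hcard : T₁.card + T₂.card = T.card := Finset.card_filter_add_card_filter_not _
  have hT₁ : 0 < T₁.card := Finset.card_pos.2 ⟨t, Finset.mem_filter.2 ⟨ht, hty.symm⟩⟩
  have hsub₂ : T₂ ⊆ T := Finset.filter_subset _ _
  have hsub₁ : T₁ ⊆ T := Finset.filter_subset _ _
  have ih₂ := ih T₂.card (by omega) T₂ (hDT.mono_right hsub₂)
    (fun x hx z hz => hI x (Finset.union_subset_union_right hsub₂ hx) z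
      (Finset.union_subset_union_right hsub₂ hz)) (fun x hx => hT x (hsub₂ hx)) rfl
  have hyT₂ : y ∉ G.nbhd T₂ := by
    rw [SimpleGraph.mem_nbhd]
    rintro ⟨x, hx, hxy⟩
    exact (Finset.mem_filter.1 hx).2 hxy.symm
  have hyN : ({y} : Finset V) ⊆ (G.nbhd T₁ \ G.nbhd D) \ G.nbhd T₂ := by
    simp only [Finset.singleton_subset_iff, Finset.mem_sdiff]
    exact ⟨⟨SimpleGraph.mem_nbhd.2 ⟨t, Finset.mem_filter.2 ⟨ht, hty.symm⟩, hty⟩, hyD⟩, hyT₂⟩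
  obtain ⟨Y, hyY, hY⟩ := exists_maximal_ge_of_wellFoundedGT
    (fun Y : Finset V => G.Indep Y ∧ Y ⊆ (G.nbhd T₁ \ G.nbhd D) \ G.nbhd T₂) {y}
    ⟨by intro x hx z hz; simp_all, hyN⟩
  have hY1 := hY.1.1
  have hY2 : ∀ z ∈ Y, z ∈ G.nbhd T₁ ∧ z ∉ G.nbhd D ∧ z ∉ G.nbhd T₂ := by
    intro z hz
    have := hY.1.2 hz
    simp only [Finset.mem_sdiff] at this
    tauto
  have hyY : y ∈ Y := hyY (Finset.mem_singleton_self y)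
  have hYdom : ∀ z, z ∈ G.nbhd T₁ → z ∉ G.nbhd D → z ∉ G.nbhd T₂ → z ∈ Y ∨ z ∈ G.nbhd Y := by
    intro z h1 h2 h3
    by_contra hcon
    push Not at hcon
    obtain ⟨hc1, hc2⟩ := hcon
    rw [SimpleGraph.mem_nbhd] at hc2
    push Not at hc2
    refine hc1 (hY.2 (y := insert z Y) ⟨?_, ?_⟩ (Finset.subset_insert _ _)
      (Finset.mem_insert_self _ _))
    · intro x hx w hw
      rw [Finset.mem_insert] at hx hw
      rcases hx with rfl | hx <;> rcases hw with rfl | hw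
      · exact G.loopless.irrefl _
      · exact fun e => hc2 w hw e.symm
      · exact hc2 x hx
      · exact hY1 x hx w hw
    · refine Finset.insert_subset ?_ hY.1.2
      simp [h1, h2, h3]
  have hDI : ∀ x ∈ D, ∀ z ∈ D, ¬ G.Adj x z := fun x hx z hz =>
    hI x (Finset.mem_union_left _ hx) z (Finset.mem_union_left _ hz)
  have hTI : ∀ x ∈ T, ∀ z ∈ T, ¬ G.Adj x z := fun x hx z hz =>
    hI x (Finset.mem_union_right _ hx) z (Finset.mem_union_right _ hz)
  have hDTI : ∀ x ∈ D, ∀ z ∈ T, ¬ G.Adj x z := fun x hx z hz =>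
    hI x (Finset.mem_union_left _ hx) z (Finset.mem_union_right _ hz)
  have hYD : ∀ x ∈ Y, ∀ z ∈ D, ¬ G.Adj x z := fun x hx z hz e =>
    (hY2 x hx).2.1 (SimpleGraph.mem_nbhd.2 ⟨z, hz, e.symm⟩)
  have hYT : ∀ x ∈ Y, ∀ z ∈ T₂, ¬ G.Adj x z := fun x hx z hz e =>
    (hY2 x hx).2.2 (SimpleGraph.mem_nbhd.2 ⟨z, hz, e.symm⟩)
  have hB : G.Indep (D ∪ T₂ ∪ Y) := by
    intro x hx z hz
    simp only [Finset.mem_union] at hx hz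
    rcases hx with (hx | hx) | hx <;> rcases hz with (hz | hz) | hz
    · exact hDI x hx z hz
    · exact hDTI x hx z (hsub₂ hz)
    · exact fun e => hYD z hz x hx e.symm
    · exact fun e => hDTI z hz x (hsub₂ hx) e.symm
    · exact hTI x (hsub₂ hx) z (hsub₂ hz)
    · exact fun e => hYT z hz x hx e.symm
    · exact hYD x hx z hz
    · exact hYT x hx z hz
    · exact hY1 x hx z hz
  -- Replacing T₁ by Y loses no domination: T₁ is dominated by y, and a neighbour of T₁ outside the
  -- neighbourhoods of D and T₂ lies in Y or next to it by maximality of Y.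
  have hle := SimpleGraph.Indep.card_le_of_closedNbhd_subset hα hI hB (by
    intro x hx
    simp only [SimpleGraph.mem_nbhd, Finset.mem_union] at hx ⊢
    rcases hx with (hx | hx) | ⟨z, hz | hz, hzx⟩
    · exact Or.inl (Or.inl (Or.inl hx))
    · by_cases hyx : G.Adj y x
      · exact Or.inr ⟨y, Or.inr hyY, hyx⟩
      · exact Or.inl (Or.inl (Or.inr (Finset.mem_filter.2 ⟨hx, hyx⟩)))
    · exact Or.inr ⟨z, Or.inl (Or.inl hz), hzx⟩
    · by_cases hyz : G.Adj y z
      · by_cases h1 : x ∈ G.nbhd D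
        · obtain ⟨w, hw, hwx⟩ := SimpleGraph.mem_nbhd.1 h1
          exact Or.inr ⟨w, Or.inl (Or.inl hw), hwx⟩
        by_cases h2 : x ∈ G.nbhd T₂
        · obtain ⟨w, hw, hwx⟩ := SimpleGraph.mem_nbhd.1 h2
          exact Or.inr ⟨w, Or.inl (Or.inr hw), hwx⟩
        rcases hYdom x (SimpleGraph.mem_nbhd.2 ⟨z, Finset.mem_filter.2 ⟨hz, hyz⟩, hzx⟩) h1 h2
          with h3 | h3
        · exact Or.inl (Or.inr h3)
        · obtain ⟨w, hw, hwx⟩ := SimpleGraph.mem_nbhd.1 h3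
          exact Or.inr ⟨w, Or.inr hw, hwx⟩
      · exact Or.inr ⟨z, Or.inl (Or.inr (Finset.mem_filter.2 ⟨hz, hyz⟩)), hzx⟩)
  rw [Finset.card_union_of_disjoint hDT] at hle
  have hle2 := (Finset.card_union_le (D ∪ T₂) Y)
  have hle3 := Finset.card_union_le D T₂
  have hsplit : Y ∪ (G.nbhd T₂ \ G.nbhd D) ⊆ G.nbhd T \ G.nbhd D := by
    intro x hx
    rw [Finset.mem_union, Finset.mem_sdiff] at hx
    rw [Finset.mem_sdiff]
    rcases hx with hx | ⟨hx, hx'⟩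
    · obtain ⟨w, hw, hwx⟩ := SimpleGraph.mem_nbhd.1 (hY2 x hx).1
      exact ⟨SimpleGraph.mem_nbhd.2 ⟨w, hsub₁ hw, hwx⟩, (hY2 x hx).2.1⟩
    · obtain ⟨w, hw, hwx⟩ := SimpleGraph.mem_nbhd.1 hx
      exact ⟨SimpleGraph.mem_nbhd.2 ⟨w, hsub₂ hw, hwx⟩, hx'⟩
  have hdj : Disjoint Y (G.nbhd T₂ \ G.nbhd D) := by
    rw [Finset.disjoint_left]
    intro x hx hx'
    exact (hY2 x hx).2.2 (Finset.mem_sdiff.1 hx').1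
  have := Finset.card_le_card hsplit
  rw [Finset.card_union_of_disjoint hdj] at this
  omega

-- Extend D to a maximal independent set M and put T = M \ D. The sets M, N(D) and N(T) \ N(D) are
-- disjoint, and the last has at least |T| = a - |D| elements, so 2a + |N(D)| ≤ n + |D|, where a = n
-- - d.
open Classical in
theorem SimpleGraph.Indep.card_add_card_nbhd_le {a d : ℕ} (had : a + d = Fintype.card V)
    (hα : ∀ M : Finset V, Maximal G.Indep M → M.card = a) (D : Finset V) (hD : G.Indep D)
    (h : ∀ x, x ∉ D → x ∉ G.nbhd D → ∃ y, G.Adj x y ∧ y ∉ G.nbhd D) :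
    Fintype.card V + (G.nbhd D).card ≤ 2 * d + D.card := by
  obtain ⟨M, hDM, hM⟩ := exists_maximal_ge_of_wellFoundedGT G.Indep D hD
  have hDM' : D ∪ (M \ D) = M := Finset.union_sdiff_of_subset hDM
  have h1 := SimpleGraph.Indep.card_le_card_nbhd_sdiff hα D (M \ D) Finset.disjoint_sdiff
    (by rw [hDM']; exact hM.1) (by
      intro t ht
      rw [Finset.mem_sdiff] at ht
      refine h t ht.2 fun hc => ?_
      obtain ⟨w, hw, hwt⟩ := SimpleGraph.mem_nbhd.1 hc
      exact hM.1 w (hDM hw) t ht.1 hwt)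
  have h2 : M ∪ (G.nbhd D ∪ (G.nbhd (M \ D) \ G.nbhd D)) ⊆ Finset.univ := Finset.subset_univ _
  have h3 := Finset.card_le_card h2
  rw [Finset.card_univ, Finset.card_union_of_disjoint, Finset.card_union_of_disjoint
    Finset.disjoint_sdiff, hα M hM] at h3
  · have h4 := Finset.card_sdiff_add_card_eq_card hDM
    rw [hα M hM] at h4
    omega
  · rw [Finset.disjoint_left]
    intro x hx hx'
    rw [Finset.mem_union, Finset.mem_sdiff] at hx'
    rcases hx' with hx' | ⟨hx', -⟩
    · obtain ⟨w, hw, hwx⟩ := SimpleGraph.mem_nbhd.1 hx'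
      exact hM.1 w (hDM hw) x hx hwx
    · obtain ⟨w, hw, hwx⟩ := SimpleGraph.mem_nbhd.1 hx'
      exact hM.1 w (Finset.mem_sdiff.1 hw).1 x hx hwx

-- Each vertex of large weight has, by criticality, a neighbour of small weight, and the vertices of
-- small weight are independent. The hypothesis on t and s makes the thresholds for "large" and
-- "small" match.
open Classical in
theorem SimpleGraph.IsCriticalCover.card_add_card_le {a d k : ℕ} {b : V → ℕ}
    (had : a + d = Fintype.card V)
    (hα : ∀ M : Finset V, Maximal G.Indep M → M.card = a) (hb : G.IsCriticalCover k b)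
    {t s : ℕ} (hts : t ≤ s) (h2 : 2 ≤ t) (hk : t + s = k + 2) :
    (Finset.univ.filter fun x => t ≤ b x).card + (Finset.univ.filter fun x => s ≤ b x).card
      ≤ 2 * d := by
  rcases hts.eq_or_lt with rfl | hts
  -- Here k = 2t - 2. Two vertices of weight t - 1 may be joined by an edge of weight exactly k, so
  -- such a vertex is admitted only if all its edges weigh at least k + 1. The critical partner of a
  -- vertex of weight at least t still lies in this set, so {b ≥ t} misses a maximal independent
  -- set.
  · have hI : G.Indep (Finset.univ.filter fun x => b x + 1 < t ∨ (b x + 1 = t ∧ ∀ z, G.Adj x z →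
        k + 1 ≤ b x + b z)) := by
      intro x hx y hy e
      simp only [Finset.mem_filter, Finset.mem_univ, true_and] at hx hy
      have := hb.1 x y e
      rcases hx with hx | ⟨hx, hx'⟩
      · omega
      · have := hx' y e
        omega
    obtain ⟨M, hM1, hM⟩ := exists_maximal_ge_of_wellFoundedGT G.Indep _ hI
    have hdj : Disjoint M (Finset.univ.filter fun x => t ≤ b x) := by
      rw [Finset.disjoint_left]
      intro x hx hx'
      simp only [Finset.mem_filter, Finset.mem_univ, true_and] at hx'
      obtain ⟨y, hxy, h⟩ := hb.2 x (by omega)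
      refine hM.1 x hx y (hM1 ?_) hxy
      simp only [Finset.mem_filter, Finset.mem_univ, true_and]
      rcases h with h | ⟨h, h', h''⟩
      · omega
      · by_cases hc : b y + 1 < t
        · exact Or.inl hc
        · exact Or.inr ⟨by omega, h''⟩
    have := Finset.card_le_card (Finset.subset_univ (M ∪ (Finset.univ.filter fun x => t ≤ b x)))
    rw [Finset.card_union_of_disjoint hdj, hα M hM, Finset.card_univ] at this
    omega
  -- Now 2(t - 1) < k, so D is independent. A vertex of weight at least s has a critical partner of
  -- weight at most k + 1 - s = t - 1, which puts {b ≥ s} inside N(D), while {b ≥ t} is the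
  -- complement of D.
  · set D := Finset.univ.filter fun x => b x < t
    have hmem : ∀ x, x ∈ D ↔ b x < t := by simp [D]
    have hD : G.Indep D := by
      intro x hx y hy e
      rw [hmem] at hx hy
      have := hb.1 x y e
      omega
    have key := SimpleGraph.Indep.card_add_card_nbhd_le had hα D hD (by
      intro x hx hx'
      rw [hmem] at hx
      rw [SimpleGraph.mem_nbhd] at hx'
      push Not at hx'
      have hx2 : ∀ y, G.Adj x y → t ≤ b y := by
        intro y hy
        by_contra hc
        exact hx' y ((hmem y).2 (by omega)) hy.symm
      obtain ⟨y, hxy, h⟩ := hb.2 x (by omega)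
      have hty := hx2 y hxy
      refine ⟨y, hxy, ?_⟩
      rw [SimpleGraph.mem_nbhd]
      rintro ⟨z, hz, hzy⟩
      rw [hmem] at hz
      have := hb.1 z y hzy
      rcases h with h | ⟨h, -, h'⟩
      · omega
      · have := h' z hzy.symm
        omega)
    have h3 : (Finset.univ.filter fun x => t ≤ b x).card + D.card = Fintype.card V := by
      have : (Finset.univ.filter fun x => t ≤ b x) = Finset.univ \ D := by
        ext x; simp [D]
      rw [this, Finset.card_sdiff_add_card_eq_card (Finset.subset_univ _), Finset.card_univ]
    have h4 : (Finset.univ.filter fun x => s ≤ b x) ⊆ G.nbhd D := by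
      intro x hx
      simp only [Finset.mem_filter, Finset.mem_univ, true_and] at hx
      obtain ⟨y, hxy, h⟩ := hb.2 x (by omega)
      refine SimpleGraph.mem_nbhd.2 ⟨y, (hmem y).2 ?_, hxy.symm⟩
      omega
    have := Finset.card_le_card h4
    omega

theorem SimpleGraph.IsCriticalCover.sum_le {a d k : ℕ} {b : V → ℕ}
    (had : a + d = Fintype.card V)
    (hα : ∀ M : Finset V, Maximal G.Indep M → M.card = a) (hb : G.IsCriticalCover k b)
    (hk : 1 ≤ k) :
    ∑ x, b x ≤ (k - 1) * d + (Finset.univ.filter fun x => 1 ≤ b x).card := by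
  set A : ℕ → ℕ := fun t => (Finset.univ.filter fun x => t ≤ b x).card
  have h1 : ∑ x, b x = ∑ t ∈ Finset.Icc 1 k, A t := by
    have : ∀ x, b x = ∑ t ∈ Finset.Icc 1 k, if t ≤ b x then 1 else 0 := by
      intro x
      rw [← Finset.card_filter]
      have : (Finset.Icc 1 k).filter (fun t => t ≤ b x) = Finset.Icc 1 (b x) := by
        ext t
        have := hb.le x
        simp only [Finset.mem_filter, Finset.mem_Icc]
        omega
      simp [this]
    rw [Finset.sum_congr rfl fun x _ => this x, Finset.sum_comm]
    exact Finset.sum_congr rfl fun t _ => by simp [A]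
  -- The reflection t ↦ k + 2 - t preserves [2, k]. The layer t = 1 would be paired with k + 1, so
  -- it stays apart as the support of b.
  have h2 : ∑ t ∈ Finset.Icc 2 k, A t = ∑ t ∈ Finset.Icc 2 k, A (k + 2 - t) := by
    refine Finset.sum_nbij' (fun t => k + 2 - t) (fun t => k + 2 - t) ?_ ?_ ?_ ?_ ?_
    all_goals intro t ht; rw [Finset.mem_Icc] at ht
    · rw [Finset.mem_Icc]; omega
    · rw [Finset.mem_Icc]; omega
    · omega
    · omega
    · congr 1; omega
  have h3 : 2 * ∑ t ∈ Finset.Icc 2 k, A t ≤ 2 * ((k - 1) * d) := by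
    calc 2 * ∑ t ∈ Finset.Icc 2 k, A t = ∑ t ∈ Finset.Icc 2 k, (A t + A (k + 2 - t)) := by
          rw [Finset.sum_add_distrib, ← h2, two_mul]
      _ ≤ ∑ t ∈ Finset.Icc 2 k, 2 * d := by
          refine Finset.sum_le_sum fun t ht => ?_
          rw [Finset.mem_Icc] at ht
          rcases le_total t (k + 2 - t) with h | h
          · exact hb.card_add_card_le had hα h ht.1 (by omega)
          · rw [add_comm]
            exact hb.card_add_card_le had hα h (by omega) (by omega)
      _ = 2 * ((k - 1) * d) := by
          rw [Finset.sum_const, Nat.card_Icc, smul_eq_mul]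
          have : k + 1 - 2 = k - 1 := by omega
          rw [this]; ring
  rw [h1, ← Finset.add_sum_Ioc_eq_sum_Icc hk]
  have : Finset.Ioc 1 k = Finset.Icc 2 k := by
    ext; simp [Nat.succ_le_iff]
  rw [this]
  change A 1 + _ ≤ _ + A 1
  omega

/-- The weight of a critical `k`-cover, all of whose vertices of positive weight lie on edges of
weight `k`. -/
theorem SimpleGraph.sum_lt_of_tight [Nonempty V] {a d k : ℕ} {b : V → ℕ}
    (had : a + d = Fintype.card V)
    (hα : ∀ M : Finset V, Maximal G.Indep M → M.card = a) (hk : 1 ≤ k)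
    (h1 : ∀ x y, G.Adj x y → k ≤ b x + b y) (h2 : ∀ x, 1 ≤ b x → ∃ y, G.Adj x y ∧ b x + b y = k) :
    ∑ x, b x < (k - 1) * d + Fintype.card V := by
  by_cases hb : ∀ x, 1 ≤ b x
  · obtain ⟨x₀⟩ := ‹Nonempty V›
    obtain ⟨y₀, hxy, h⟩ := h2 x₀ (hb x₀)
    have hy₀ := hb y₀
    have hx₀ := hb x₀
    -- With full support, b counts as a critical (k - 1)-cover through the second alternative of the
    -- definition: its tight edges have weight (k - 1) + 1. This saves d > 0 in the bound; k ≥ 2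
    -- because a tight edge has two positive ends.
    have hcrit : G.IsCriticalCover (k - 1) b := by
      refine ⟨fun x y e => (Nat.sub_le _ _).trans (h1 x y e), fun x hx => ?_⟩
      obtain ⟨y, e, h⟩ := h2 x hx
      refine ⟨y, e, Or.inr ⟨by omega, hb y, fun z hz => ?_⟩⟩
      have := h1 y z hz
      omega
    have hle := hcrit.sum_le had hα (by omega)
    have hc : (Finset.univ.filter fun x => 1 ≤ b x).card ≤ Fintype.card V := Finset.card_le_univ _
    have hd : 0 < d := by
      obtain ⟨M, -, hM⟩ := exists_maximal_ge_of_wellFoundedGT G.Indep ∅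
        (by intro x hx; simp at hx)
      rcases Nat.eq_zero_or_pos d with rfl | hd
      · have : M = Finset.univ := by
          rw [← Finset.card_eq_iff_eq_univ, hα M hM, ← had]; rfl
        exact absurd hxy (hM.1 x₀ (by simp [this]) y₀ (by simp [this]))
      · exact hd
    have : (k - 1 - 1) * d + d = (k - 1) * d := by
      obtain ⟨j, rfl⟩ : ∃ j, k = j + 2 := ⟨k - 2, by omega⟩
      simp only [Nat.add_sub_cancel, show j + 2 - 1 = j + 1 by omega]
      ring
    omega
  · push Not at hb
    obtain ⟨x₀, hx₀⟩ := hb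
    have hcrit : G.IsCriticalCover k b := by
      refine ⟨h1, fun x hx => ?_⟩
      obtain ⟨y, e, h⟩ := h2 x hx
      exact ⟨y, e, Or.inl h⟩
    have hle := hcrit.sum_le had hα hk
    have hc : (Finset.univ.filter fun x => 1 ≤ b x).card < Fintype.card V := by
      rw [← Finset.card_univ]
      refine Finset.card_lt_card ⟨Finset.subset_univ _, fun h => ?_⟩
      have := h (Finset.mem_univ x₀)
      simp at this
      omega
    omega

end Combinatorics

/-! ### The Koszul complex and contraction towards a cone vertex. -/

section Koszul

variable {V : Type u} [LinearOrder V]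

/-- The sign `(-1) ^ #{u ∈ τ | u < x}`. -/
def koszulSign (x : V) (τ : Finset V) : ℤ :=
  (-1) ^ (τ.filter (· < x)).card

theorem koszulSign_mul_self (x : V) (τ : Finset V) : koszulSign x τ * koszulSign x τ = 1 := by
  rw [koszulSign, ← mul_pow]; simp

theorem koszulSign_insert {x y : V} {τ : Finset V} (hy : y ∉ τ) :
    koszulSign x (insert y τ) = if y < x then -koszulSign x τ else koszulSign x τ := by
  unfold koszulSign
  rw [Finset.filter_insert]
  split_ifs with h
  · rw [Finset.card_insert_of_notMem (by simp [hy]), pow_succ]; ring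
  · rfl

theorem koszulSign_swap {x y : V} {τ : Finset V} (hxy : x ≠ y) (hx : x ∉ τ) (hy : y ∉ τ) :
    koszulSign x τ * koszulSign y (insert x τ) = -(koszulSign y τ * koszulSign x (insert y τ)) := by
  rw [koszulSign_insert hx, koszulSign_insert hy]
  rcases hxy.lt_or_gt with h | h
  · rw [if_pos h, if_neg h.not_gt]; ring
  · rw [if_pos h, if_neg h.not_gt]; ring

theorem koszulSign_insert_mul_insert {x y : V} {τ : Finset V} (hxy : x ≠ y) (hx : x ∉ τ) (hy : y ∉ τ) :
    koszulSign x (insert y τ) * koszulSign y (insert x τ) =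
      -(koszulSign x τ * koszulSign y τ) := by
  rw [koszulSign_insert hx, koszulSign_insert hy]
  rcases hxy.lt_or_gt with h | h
  · rw [if_pos h, if_neg h.not_gt]; ring
  · rw [if_pos h, if_neg h.not_gt]; ring

/-- The exponent vector of the squarefree monomial with support `τ`. -/
noncomputable def setExp {V : Type u} (τ : Finset V) : V →₀ ℕ := ∑ x ∈ τ, Finsupp.single x 1

theorem setExp_insert {x : V} {τ : Finset V} (hx : x ∉ τ) :
    setExp (insert x τ) = Finsupp.single x 1 + setExp τ := Finset.sum_insert hx

theorem setExp_erase {x : V} {τ : Finset V} (hx : x ∈ τ) :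
    Finsupp.single x 1 + setExp (τ.erase x) = setExp τ :=
  Finset.add_sum_erase τ (fun x => Finsupp.single x 1) hx

theorem setExp_apply {V : Type u} [DecidableEq V] (τ : Finset V) (x : V) : setExp τ x = if x ∈ τ then 1 else 0 := by
  simp [setExp, Finsupp.finsetSum_apply, Finsupp.single_apply]

theorem setExp_degree {V : Type u} (τ : Finset V) : (setExp τ).degree = τ.card := by
  simp [setExp, map_sum, Finsupp.degree_single]

open Classical in
/-- A contracting homotopy of the Koszul complex. The function `c` chooses a variable for every
multidegree. -/
noncomputable def koszulHomotopy {K : Type v} [Field K] (c : (V →₀ ℕ) → V) (f : Finset V → MvPolynomial V K)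
    (τ : Finset V) : MvPolynomial V K :=
  ∑ x ∈ τ, ∑ m ∈ (f (τ.erase x)).support.filter (fun m => c (m + setExp (τ.erase x)) = x),
    koszulSign x (τ.erase x) • monomial (m - Finsupp.single x 1) (coeff m (f (τ.erase x)))

-- The homotopy preserves the multidegree m + `setExp τ`, so only the variable chosen for that
-- multidegree contributes. The hypothesis on `c` ensures that the truncated subtraction in the
-- definition is a true division by that variable.
open Classical in
theorem coeff_koszulHomotopy {K : Type v} [Field K] (c : (V →₀ ℕ) → V) (f : Finset V → MvPolynomial V K)
    (hc : ∀ σ, ∀ m ∈ (f σ).support, c (m + setExp σ) ∉ σ → 1 ≤ m (c (m + setExp σ)))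
    (τ : Finset V) (m : V →₀ ℕ) :
    coeff m (koszulHomotopy c f τ) = if c (m + setExp τ) ∈ τ then
      koszulSign (c (m + setExp τ)) (τ.erase (c (m + setExp τ))) •
        coeff (m + Finsupp.single (c (m + setExp τ)) 1) (f (τ.erase (c (m + setExp τ)))) else 0 := by
  have inner : ∀ x ∈ τ, coeff m (∑ m ∈ (f (τ.erase x)).support.filter
      (fun m => c (m + setExp (τ.erase x)) = x), koszulSign x (τ.erase x) •
        monomial (m - Finsupp.single x 1) (coeff m (f (τ.erase x)))) =
      if c (m + setExp τ) = x then koszulSign x (τ.erase x) •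
        coeff (m + Finsupp.single x 1) (f (τ.erase x)) else 0 := by
    intro x hx
    have hb : m + Finsupp.single x 1 + setExp (τ.erase x) = m + setExp τ := by
      rw [add_assoc, setExp_erase hx]
    rw [Finset.sum_filter, coeff_sum, Finset.sum_eq_single (m + Finsupp.single x 1)]
    · rw [hb]
      split_ifs with h
      · rw [coeff_smul, add_tsub_cancel_right, coeff_monomial, if_pos rfl]
      · exact coeff_zero _
    · intro m' hm' hne
      split_ifs with h
      · rw [coeff_smul, coeff_monomial, if_neg, smul_zero]
        rintro rfl
        apply hne
        have := hc (τ.erase x) m' hm' (by rw [h]; simp)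
        rw [h] at this
        rw [tsub_add_cancel_of_le (by simpa using this)]
      · exact coeff_zero _
    · intro hn
      rw [notMem_support_iff] at hn
      simp [hn]
  rw [koszulHomotopy, coeff_sum, Finset.sum_congr rfl inner, Finset.sum_ite_eq]

variable [Fintype V] {K : Type v} [Field K]

/-- The differential of the Koszul complex of the variables with coefficients in `M`. An element of
the complex is a family of elements of `M` indexed by the subsets of the set of variables. -/
noncomputable def koszulBdry {M : Type*} [AddCommGroup M] [Module (MvPolynomial V K) M] :
    (Finset V → M) →ₗ[MvPolynomial V K] (Finset V → M) where
  toFun f τ := ∑ x ∈ τᶜ, koszulSign x τ • (X x : MvPolynomial V K) • f (insert x τ)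
  map_add' f g := by
    ext τ; simp [smul_add, Finset.sum_add_distrib]
  map_smul' c f := by
    ext τ
    simp only [Pi.smul_apply, RingHom.id_apply, Finset.smul_sum]
    refine Finset.sum_congr rfl fun x _ => ?_
    rw [smul_comm c (koszulSign x τ), smul_comm c (X x : MvPolynomial V K)]

section
variable {M : Type*} [AddCommGroup M] [Module (MvPolynomial V K) M]

theorem koszulBdry_apply (f : Finset V → M) (τ : Finset V) :
    koszulBdry (K := K) f τ =
      ∑ x ∈ τᶜ, koszulSign x τ • (X x : MvPolynomial V K) • f (insert x τ) := rfl

theorem koszulBdry_bdry (f : Finset V → M) :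
    koszulBdry (K := K) (koszulBdry (K := K) f) = 0 := by
  ext τ
  rw [koszulBdry_apply]
  simp only [koszulBdry_apply, Finset.smul_sum, Pi.zero_apply]
  rw [Finset.sum_sigma']
  refine Finset.sum_involution (fun p _ => ⟨p.2, p.1⟩) ?_ ?_ ?_ ?_
  · rintro ⟨x, y⟩ h
    simp only [Finset.mem_sigma, Finset.mem_compl, Finset.mem_insert, not_or] at h ⊢
    rw [Finset.insert_comm x y]
    have e : ∀ (a b : ℤ) (p q : MvPolynomial V K) (m : M),
        a • p • b • q • m = (a * b) • (p * q) • m := by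
      intro a b p q m
      rw [smul_comm p b, smul_smul, smul_smul]
    rw [e, e, koszulSign_swap (Ne.symm h.2.1) h.1 h.2.2, mul_comm (X y), ← add_smul]
    simp
  · rintro ⟨_, y⟩ h - heq
    simp only [Finset.mem_sigma, Finset.mem_compl, Finset.mem_insert, not_or] at h
    exact h.2.1 (congrArg Sigma.fst heq)
  · rintro ⟨x, y⟩ h
    simp only [Finset.mem_sigma, Finset.mem_compl, Finset.mem_insert, not_or] at h ⊢
    exact ⟨h.2.2, Ne.symm h.2.1, h.1⟩
  · exact fun _ _ => rfl

theorem koszulBdry_map {N : Type*} [AddCommGroup N] [Module (MvPolynomial V K) N]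
    (φ : M →ₗ[MvPolynomial V K] N) (f : Finset V → M) :
    koszulBdry (K := K) (fun τ => φ (f τ)) = fun τ => φ (koszulBdry (K := K) f τ) := by
  ext τ
  simp [koszulBdry_apply, map_sum, map_zsmul, map_smul]

theorem koszulBdry_support {f : Finset V → M} {j : ℕ} (hf : ∀ τ, τ.card ≠ j + 1 → f τ = 0)
    (τ : Finset V) (hτ : τ.card ≠ j) : koszulBdry (K := K) f τ = 0 := by
  refine Finset.sum_eq_zero fun x hx => ?_
  rw [hf, smul_zero, smul_zero]
  rw [Finset.card_insert_of_notMem (Finset.mem_compl.1 hx)]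
  omega

end

theorem coeff_koszulBdry (f : Finset V → MvPolynomial V K) (τ : Finset V) (m : V →₀ ℕ) :
    coeff m (koszulBdry (K := K) f τ) = ∑ x ∈ τᶜ, koszulSign x τ •
      (if x ∈ m.support then coeff (m - Finsupp.single x 1) (f (insert x τ)) else 0) := by
  rw [koszulBdry_apply, coeff_sum]
  refine Finset.sum_congr rfl fun x _ => ?_
  rw [coeff_smul, smul_eq_mul, coeff_X_mul']

/-- Acyclicity of the Koszul complex in multidegrees with a cone vertex. -/
theorem exists_koszulBdry_eq_of_cone [Nonempty V] (P : Set (V →₀ ℕ)) (j : ℕ)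
    (f : Finset V → MvPolynomial V K) (hP : ∀ τ, ∀ m ∈ (f τ).support, m ∈ P)
    (hj : ∀ τ, τ.card ≠ j → f τ = 0) (hf : koszulBdry (K := K) f = 0)
    (hc : ∀ τ, τ.card = j → ∀ m ∈ (f τ).support, ∃ x, ∀ (σ : Finset V) (m' : V →₀ ℕ),
      σ.card = j → x ∉ σ → m' + setExp σ = m + setExp τ → m' ∈ P →
        1 ≤ m' x ∧ m' - Finsupp.single x 1 ∈ P) :
    ∃ g : Finset V → MvPolynomial V K, (∀ τ, ∀ m ∈ (g τ).support, m ∈ P) ∧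
      (∀ τ, τ.card ≠ j + 1 → g τ = 0) ∧ koszulBdry (K := K) g = f := by
  classical
  -- The chosen variable may depend on the multidegree alone, not on the pair (τ, m) that realises
  -- it. Multidegrees without a cone vertex get an arbitrary one.
  have hex : ∀ b : V →₀ ℕ, ∃ x : V, (∃ x, ∀ (σ : Finset V) (m' : V →₀ ℕ),
      σ.card = j → x ∉ σ → m' + setExp σ = b → m' ∈ P →
        1 ≤ m' x ∧ m' - Finsupp.single x 1 ∈ P) → ∀ (σ : Finset V) (m' : V →₀ ℕ),
      σ.card = j → x ∉ σ → m' + setExp σ = b → m' ∈ P →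
        1 ≤ m' x ∧ m' - Finsupp.single x 1 ∈ P := by
    intro b
    by_cases h : ∃ x, ∀ (σ : Finset V) (m' : V →₀ ℕ),
      σ.card = j → x ∉ σ → m' + setExp σ = b → m' ∈ P →
        1 ≤ m' x ∧ m' - Finsupp.single x 1 ∈ P
    · obtain ⟨x, hx⟩ := h
      exact ⟨x, fun _ => hx⟩
    · exact ⟨Classical.arbitrary V, fun h' => absurd h' h⟩
  choose c hcc using hex
  have hcard : ∀ σ, ∀ m ∈ (f σ).support, σ.card = j := by
    intro σ m hm
    by_contra hne
    rw [hj σ hne] at hm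
    simp at hm
  have hc1 : ∀ σ, ∀ m ∈ (f σ).support, c (m + setExp σ) ∉ σ → 1 ≤ m (c (m + setExp σ)) ∧
      m - Finsupp.single (c (m + setExp σ)) 1 ∈ P := by
    intro σ m hm hn
    exact hcc _ (hc σ (hcard σ m hm) m hm) σ m (hcard σ m hm) hn rfl (hP σ m hm)
  have hg := coeff_koszulHomotopy c f fun σ m hm hn => (hc1 σ m hm hn).1
  refine ⟨koszulHomotopy c f, ?_, ?_, ?_⟩
  · intro τ m hm
    rw [mem_support_iff, hg] at hm
    split_ifs at hm with h
    · have hm' : m + Finsupp.single (c (m + setExp τ)) 1 ∈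
          (f (τ.erase (c (m + setExp τ)))).support := by
        rw [mem_support_iff]
        exact fun h0 => hm (by rw [h0, smul_zero])
      have hb : m + Finsupp.single (c (m + setExp τ)) 1 +
          setExp (τ.erase (c (m + setExp τ))) = m + setExp τ := by
        rw [add_assoc, setExp_erase h]
      have := (hc1 _ _ hm' (by rw [hb]; simp)).2
      rw [hb, add_tsub_cancel_right] at this
      exact this
    · exact absurd rfl hm
  · intro τ hτ
    ext m
    rw [hg, coeff_zero]
    split_ifs with h
    · rw [hj, coeff_zero, smul_zero]
      have := Finset.card_erase_add_one h
      omega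
    · rfl
  · ext τ m
    rw [coeff_koszulBdry]
    set b := m + setExp τ with hb
    set w := c b with hw
    have hterm : ∀ x ∈ τᶜ, koszulSign x τ • (if x ∈ m.support then
        coeff (m - Finsupp.single x 1) (koszulHomotopy c f (insert x τ)) else 0) =
        if x ∈ m.support ∧ w ∈ insert x τ then koszulSign x τ •
          koszulSign w ((insert x τ).erase w) •
            coeff (m - Finsupp.single x 1 + Finsupp.single w 1) (f ((insert x τ).erase w))
        else 0 := by
      intro x hx
      rw [Finset.mem_compl] at hx
      by_cases hxm : x ∈ m.support
      · have hxm' : Finsupp.single x 1 ≤ m := by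
          rw [Finsupp.mem_support_iff] at hxm
          simpa [Nat.one_le_iff_ne_zero] using hxm
        have hb' : m - Finsupp.single x 1 + setExp (insert x τ) = b := by
          rw [setExp_insert hx, ← add_assoc, tsub_add_cancel_of_le hxm']
        rw [if_pos hxm, hg, hb', ← hw]
        simp only [hxm, true_and]
        split_ifs <;> simp
      · simp [hxm]
    rw [Finset.sum_congr rfl hterm]
    -- If w ∈ τ, the terms of the boundary match, up to a common sign, those of the cycle equation
    -- at τ \ {w} other than the one for w, which is the wanted coefficient. If w ∉ τ, only the term
    -- x = w survives, and it is that coefficient.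
    by_cases hwτ : w ∈ τ
    · have hcyc := congrArg (coeff (m + Finsupp.single w 1)) (congrFun hf (τ.erase w))
      rw [coeff_koszulBdry, Pi.zero_apply, coeff_zero] at hcyc
      have hcompl : (τ.erase w)ᶜ = insert w τᶜ := by
        ext y; by_cases h : y = w <;> simp [h]
      rw [hcompl, Finset.sum_insert (by simp [hwτ]), if_pos (by simp), add_tsub_cancel_right,
        Finset.insert_erase hwτ] at hcyc
      have h2 : ∑ x ∈ τᶜ, (if x ∈ m.support ∧ w ∈ insert x τ then koszulSign x τ •
          koszulSign w ((insert x τ).erase w) •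
            coeff (m - Finsupp.single x 1 + Finsupp.single w 1) (f ((insert x τ).erase w))
          else 0) = -(koszulSign w (τ.erase w) • ∑ x ∈ τᶜ, koszulSign x (τ.erase w) •
            (if x ∈ (m + Finsupp.single w 1).support then
              coeff (m + Finsupp.single w 1 - Finsupp.single x 1) (f (insert x (τ.erase w)))
            else 0)) := by
        rw [Finset.smul_sum, ← Finset.sum_neg_distrib]
        refine Finset.sum_congr rfl fun x hx => ?_
        rw [Finset.mem_compl] at hx
        have hxw : x ≠ w := fun h => hx (h ▸ hwτ)
        have h1 : x ∈ (m + Finsupp.single w 1).support ↔ x ∈ m.support := by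
          simp [hxw.symm]
        by_cases hxm : x ∈ m.support
        · rw [if_pos ⟨hxm, Finset.mem_insert_of_mem hwτ⟩, if_pos (h1.2 hxm)]
          have hxm' : Finsupp.single x 1 ≤ m := by
            rw [Finsupp.mem_support_iff] at hxm
            simpa [Nat.one_le_iff_ne_zero] using hxm
          have e1 : (insert x τ).erase w = insert x (τ.erase w) := by
            rw [Finset.erase_insert_of_ne hxw]
          have e2 : m - Finsupp.single x 1 + Finsupp.single w 1 =
              m + Finsupp.single w 1 - Finsupp.single x 1 := by
            rw [tsub_add_eq_add_tsub hxm']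
          rw [e1, e2, smul_smul, smul_smul, ← neg_smul]
          congr 1
          have := koszulSign_insert_mul_insert (τ := τ.erase w) hxw (by simp [hx]) (by simp)
          rw [Finset.insert_erase hwτ] at this
          rw [this]; ring
        · rw [if_neg (fun h => hxm h.1), if_neg (fun h => hxm (h1.1 h))]
          simp
      rw [h2, ← smul_neg, neg_eq_of_add_eq_zero_left hcyc, smul_smul, koszulSign_mul_self,
        one_smul]
    · rw [Finset.sum_eq_single w]
      · have e1 : (insert w τ).erase w = τ := Finset.erase_insert hwτ
        by_cases h0 : coeff m (f τ) = 0
        · split_ifs with h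
          · have hle : Finsupp.single w 1 ≤ m := by
              have := h.1
              rw [Finsupp.mem_support_iff] at this
              simpa [Nat.one_le_iff_ne_zero] using this
            rw [e1, tsub_add_cancel_of_le hle, h0]; simp
          · exact h0.symm
        · have hm := (hc1 τ m (mem_support_iff.2 h0) hwτ).1
          have hle : Finsupp.single w 1 ≤ m := by simpa using hm
          rw [if_pos ⟨by rw [Finsupp.mem_support_iff]; change 1 ≤ m w at hm; omega,
            Finset.mem_insert_self _ _⟩, e1, tsub_add_cancel_of_le hle, smul_smul,
            koszulSign_mul_self, one_smul]
      · intro x hx hne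
        rw [if_neg]
        rintro ⟨-, h⟩
        rw [Finset.mem_insert] at h
        exact h.elim (fun h => hne h.symm) hwτ
      · intro h
        exact absurd (Finset.mem_compl.2 hwτ) h

end Koszul

/-! ### Homogeneous components in graded free modules. -/

section Grading

variable {V : Type u} {K : Type v} [Field K]

/-- The component of a polynomial in an integral degree. -/
noncomputable def formComp (e : ℤ) : MvPolynomial V K →ₗ[K] MvPolynomial V K :=
  if 0 ≤ e then homogeneousComponent e.toNat else 0

theorem coeff_formComp (e : ℤ) (p : MvPolynomial V K) (m : V →₀ ℕ) :
    coeff m (formComp e p) = if (m.degree : ℤ) = e then coeff m p else 0 := by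
  unfold formComp
  split_ifs with h h' h'
  · rw [coeff_homogeneousComponent, if_pos (by omega)]
  · rw [coeff_homogeneousComponent, if_neg (by omega)]
  · omega
  · simp

theorem isFormOfDegree_formComp (e : ℤ) (p : MvPolynomial V K) :
    IsFormOfDegree (formComp e p) e := by
  intro m hm
  rw [mem_support_iff, coeff_formComp] at hm
  by_contra h
  rw [if_neg h] at hm
  exact hm rfl

theorem IsFormOfDegree.formComp_eq {e : ℤ} {p : MvPolynomial V K} (hp : IsFormOfDegree p e) :
    formComp e p = p := by
  ext m
  rw [coeff_formComp]
  split_ifs with h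
  · rfl
  · by_contra h0
    exact h (hp m (mem_support_iff.2 (Ne.symm h0)))

theorem IsFormOfDegree.formComp_mul {c : ℤ} {q : MvPolynomial V K} (hq : IsFormOfDegree q c)
    (e : ℤ) (p : MvPolynomial V K) : formComp e (p * q) = formComp (e - c) p * q := by
  classical
  ext m
  have hterm : ∀ z ∈ Finset.HasAntidiagonal.antidiagonal m, coeff z.1 (formComp (e - c) p) * coeff z.2 q =
      if (m.degree : ℤ) = e then coeff z.1 p * coeff z.2 q else 0 := by
    intro z hz
    rw [coeff_formComp]
    by_cases h0 : coeff z.2 q = 0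
    · simp [h0]
    · have h1 := hq z.2 (mem_support_iff.2 h0)
      have h2 : (m.degree : ℤ) = z.1.degree + z.2.degree := by
        rw [← Finset.HasAntidiagonal.mem_antidiagonal.1 hz, map_add]; push_cast; rfl
      have h3 : (z.1.degree : ℤ) = e - c ↔ (m.degree : ℤ) = e := by omega
      simp only [h3, ite_mul, zero_mul]
  rw [coeff_formComp, coeff_mul, coeff_mul, Finset.sum_congr rfl hterm]
  split_ifs <;> simp

theorem isFormOfDegree_X (x : V) : IsFormOfDegree (X x : MvPolynomial V K) 1 := by
  intro m hm
  rw [support_X, Finset.mem_singleton] at hm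
  rw [hm, Finsupp.degree_single]; rfl

theorem IsFormOfDegree.constantCoeff_eq_zero {e : ℤ} {p : MvPolynomial V K}
    (hp : IsFormOfDegree p e) (he : e ≠ 0) : constantCoeff p = 0 := by
  by_contra h
  rw [constantCoeff_eq, ← Ne, ← mem_support_iff] at h
  have := hp 0 h
  simp at this
  omega

variable {ι κ : Type*}

/-- The component of degree `e` of an element of the graded free module with basis elements in the
degrees `s`. -/
noncomputable def vecComp (s : κ → ℤ) (e : ℤ) :
    (κ → MvPolynomial V K) →ₗ[K] (κ → MvPolynomial V K) :=
  LinearMap.pi fun a => formComp (e - s a) ∘ₗ LinearMap.proj a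

theorem vecComp_apply (s : κ → ℤ) (e : ℤ) (y : κ → MvPolynomial V K) (a : κ) :
    vecComp s e y a = formComp (e - s a) (y a) := rfl

/-- Homogeneity of an element of the graded free module with basis elements in degrees `s`. -/
def IsVecForm (s : κ → ℤ) (e : ℤ) (y : κ → MvPolynomial V K) : Prop :=
  ∀ a, IsFormOfDegree (y a) (e - s a)

theorem isVecForm_vecComp (s : κ → ℤ) (e : ℤ) (y : κ → MvPolynomial V K) :
    IsVecForm s e (vecComp s e y) := fun _ => isFormOfDegree_formComp _ _

theorem IsVecForm.vecComp_eq {s : κ → ℤ} {e : ℤ} {y : κ → MvPolynomial V K}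
    (hy : IsVecForm s e y) : vecComp s e y = y := funext fun a => (hy a).formComp_eq

theorem isVecForm_zero (s : κ → ℤ) (e : ℤ) : IsVecForm s e (0 : κ → MvPolynomial V K) := by
  intro a m hm; simp at hm

theorem vecComp_X_smul (s : κ → ℤ) (e : ℤ) (x : V) (y : κ → MvPolynomial V K) :
    vecComp s e ((X x : MvPolynomial V K) • y) = (X x : MvPolynomial V K) • vecComp s (e - 1) y := by
  funext a
  simp only [vecComp_apply, Pi.smul_apply, smul_eq_mul]
  rw [mul_comm, (isFormOfDegree_X x).formComp_mul, mul_comm]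
  congr 3; ring

/-- A map of graded free modules that is homogeneous of degree zero. -/
def IsHomogMap [DecidableEq ι] (s' : ι → ℤ) (s : κ → ℤ)
    (φ : (ι → MvPolynomial V K) →ₗ[MvPolynomial V K] (κ → MvPolynomial V K)) : Prop :=
  ∀ b a, IsFormOfDegree (φ (Pi.single b 1) a) (s' b - s a)

variable [DecidableEq ι] [Fintype ι] {s' : ι → ℤ} {s : κ → ℤ}
  {φ : (ι → MvPolynomial V K) →ₗ[MvPolynomial V K] (κ → MvPolynomial V K)}

theorem linearMap_apply_eq_sum (φ : (ι → MvPolynomial V K) →ₗ[MvPolynomial V K]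
    (κ → MvPolynomial V K)) (y : ι → MvPolynomial V K) (a : κ) :
    φ y a = ∑ b, y b * φ (Pi.single b 1) a := by
  have hy : y = ∑ b, y b • (Pi.single b 1 : ι → MvPolynomial V K) := by
    conv_lhs => rw [← Finset.univ_sum_single y]
    refine Finset.sum_congr rfl fun b _ => ?_
    rw [← Pi.single_smul, smul_eq_mul, mul_one]
  conv_lhs => rw [hy, map_sum, Finset.sum_apply]
  exact Finset.sum_congr rfl fun b _ => by rw [map_smul]; rfl

theorem IsHomogMap.vecComp_apply (hφ : IsHomogMap s' s φ) (e : ℤ) (y : ι → MvPolynomial V K) :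
    vecComp s e (φ y) = φ (vecComp s' e y) := by
  funext a
  rw [_root_.vecComp_apply, linearMap_apply_eq_sum, linearMap_apply_eq_sum, map_sum]
  refine Finset.sum_congr rfl fun b _ => ?_
  rw [(hφ b a).formComp_mul, _root_.vecComp_apply]
  congr 3; ring

theorem constantCoeff_linearMap_apply (h : ∀ b a, constantCoeff (φ (Pi.single b 1) a) = 0)
    (y : ι → MvPolynomial V K) (a : κ) : constantCoeff (φ y a) = 0 := by
  rw [linearMap_apply_eq_sum, map_sum]
  exact Finset.sum_eq_zero fun b _ => by rw [map_mul, h, mul_zero]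

end Grading

/-! ### Betti numbers of a minimal resolution as Koszul homology. -/

section Resolution

variable {V : Type u} {K : Type v} [Field K]

/-- An ideal as a submodule of the free module of rank one. -/
noncomputable def Ideal.toRankOne (I : Ideal (MvPolynomial V K)) :
    Submodule (MvPolynomial V K) (Unit → MvPolynomial V K) :=
  Submodule.comap (LinearMap.proj ()) I

namespace GradedFreeResolution

variable {I : Ideal (MvPolynomial V K)}

/-- The augmentation of a resolution with values in the free module of rank one. -/
noncomputable def augRankOne (F : GradedFreeResolution I) :
    (Fin (F.rank 0) → MvPolynomial V K) →ₗ[MvPolynomial V K] (Unit → MvPolynomial V K) :=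
  LinearMap.pi fun _ => F.aug

theorem ker_augRankOne (F : GradedFreeResolution I) :
    LinearMap.ker F.augRankOne = LinearMap.ker F.aug := by
  ext y
  simp [augRankOne, funext_iff]

theorem range_augRankOne (F : GradedFreeResolution I) :
    LinearMap.range F.augRankOne = I.toRankOne := by
  ext y
  have h : y ∈ I.toRankOne ↔ y () ∈ LinearMap.range F.aug := by
    rw [F.range_aug]; rfl
  rw [h]
  constructor
  · rintro ⟨z, rfl⟩
    exact ⟨z, rfl⟩
  · rintro ⟨z, hz⟩
    exact ⟨z, funext fun _ => hz⟩

theorem isHomogMap_augRankOne (F : GradedFreeResolution I) :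
    IsHomogMap (F.shift 0) (fun _ => 0) F.augRankOne := fun b _ => by
  rw [sub_zero]
  exact F.aug_homogeneous b

theorem IsMinimal.ker_augRankOne {F : GradedFreeResolution I} (hF : F.IsMinimal) :
    ∀ y ∈ LinearMap.ker F.augRankOne, ∀ b, constantCoeff (y b) = 0 := by
  intro y hy b
  rw [F.ker_augRankOne, ← F.exact_zero] at hy
  obtain ⟨z, rfl⟩ := hy
  exact constantCoeff_linearMap_apply (hF 0) z b

theorem IsMinimal.ker_d {F : GradedFreeResolution I} (hF : F.IsMinimal) (i : ℕ) :
    ∀ y ∈ LinearMap.ker (F.d i), ∀ b, constantCoeff (y b) = 0 := by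
  intro y hy b
  rw [← F.exact_succ] at hy
  obtain ⟨z, rfl⟩ := hy
  exact constantCoeff_linearMap_apply (hF (i + 1)) z b

end GradedFreeResolution

end Resolution

section KoszulHomology

variable {V : Type u} [LinearOrder V] [Fintype V] {K : Type v} [Field K]
variable {ι κ : Type*} [DecidableEq ι] [Fintype ι] {s' : ι → ℤ} {s : κ → ℤ}
  {φ : (ι → MvPolynomial V K) →ₗ[MvPolynomial V K] (κ → MvPolynomial V K)}

/-- The vanishing of the component of degree `e` of the `j`-th Koszul homology of a graded submodule
of a free module. -/
def KoszulVanishes (N : Submodule (MvPolynomial V K) (κ → MvPolynomial V K)) (s : κ → ℤ) (j : ℕ)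
    (e : ℤ) : Prop :=
  ∀ f : Finset V → κ → MvPolynomial V K, (∀ τ, f τ ∈ N) → (∀ τ, τ.card ≠ j → f τ = 0) →
    (∀ τ, IsVecForm s (e - τ.card) (f τ)) → koszulBdry (K := K) f = 0 →
    ∃ g : Finset V → κ → MvPolynomial V K, (∀ τ, g τ ∈ N) ∧ (∀ τ, τ.card ≠ j + 1 → g τ = 0) ∧
      koszulBdry (K := K) g = f

theorem koszulBdry_vecComp (s : κ → ℤ) (e : ℤ) (g : Finset V → κ → MvPolynomial V K) :
    koszulBdry (K := K) (fun τ => vecComp s (e - τ.card) (g τ)) =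
      fun τ => vecComp s (e - τ.card) (koszulBdry (K := K) g τ) := by
  funext τ
  rw [koszulBdry_apply, koszulBdry_apply, map_sum]
  refine Finset.sum_congr rfl fun x hx => ?_
  rw [map_zsmul, vecComp_X_smul, Finset.card_insert_of_notMem (Finset.mem_compl.1 hx)]
  congr 4
  push_cast; ring

/-- Acyclicity of the Koszul complex of a free module. -/
theorem exists_koszulBdry_eq [Nonempty V] (j : ℕ) (f : Finset V → κ → MvPolynomial V K)
    (hj : ∀ τ, τ.card ≠ j → f τ = 0) (hf : koszulBdry (K := K) f = 0)
    (h0 : ∀ τ a, j = 0 → constantCoeff (f τ a) = 0) :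
    ∃ g : Finset V → κ → MvPolynomial V K, (∀ τ, τ.card ≠ j + 1 → g τ = 0) ∧
      koszulBdry (K := K) g = f := by
  have key : ∀ a, ∃ g : Finset V → MvPolynomial V K, (∀ τ, ∀ m ∈ (g τ).support, m ∈ Set.univ) ∧
      (∀ τ, τ.card ≠ j + 1 → g τ = 0) ∧ koszulBdry (K := K) g = fun τ => f τ a := by
    intro a
    refine exists_koszulBdry_eq_of_cone Set.univ j _ (fun _ _ _ => trivial)
      (fun τ hτ => by rw [hj τ hτ]; rfl) ?_ ?_
    · have := koszulBdry_map (LinearMap.proj (R := MvPolynomial V K)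
        (φ := fun _ => MvPolynomial V K) a) f
      rw [hf] at this
      exact this
    · intro τ hτ m hm
      -- Over the whole polynomial ring any variable occurring in the multidegree is a cone vertex.
      -- Multidegree 0 occurs only for j = 0 and is excluded by `h0`.
      have hb : m + setExp τ ≠ 0 := by
        intro hb
        rw [add_eq_zero] at hb
        have hdeg := setExp_degree τ
        rw [hb.2, hτ] at hdeg
        have := h0 τ a (by simpa using hdeg.symm)
        rw [hb.1, mem_support_iff] at hm
        exact hm this
      obtain ⟨x, hx⟩ := Finsupp.ne_iff.1 hb
      refine ⟨x, fun σ m' _ hxσ heq _ => ⟨?_, trivial⟩⟩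
      rw [← heq, Finsupp.add_apply, setExp_apply, if_neg hxσ, add_zero] at hx
      exact Nat.one_le_iff_ne_zero.2 hx
  choose g _ hg1 hg2 using key
  refine ⟨fun τ a => g a τ, fun τ hτ => funext fun a => hg1 a τ hτ, ?_⟩
  funext τ a
  have := koszulBdry_map (LinearMap.proj (R := MvPolynomial V K)
        (φ := fun _ => MvPolynomial V K) a) (fun τ a => g a τ)
  exact (congrFun this τ).symm.trans (congrFun (hg2 a) τ)

/-- Long exact sequence of 0 → ker φ → F → range φ → 0: the free module F has no Koszul homology in
positive degrees, so the connecting map H_{j+1}(range φ) → H_j(ker φ) is bijective. For j = 0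
surjectivity also needs H_0(ker φ) → H_0(F) to vanish, which is `hker`. -/
theorem koszulVanishes_range_succ_iff [Nonempty V] (hφ : IsHomogMap s' s φ)
    (hker : ∀ y ∈ LinearMap.ker φ, ∀ b, constantCoeff (y b) = 0) (j : ℕ) (e : ℤ) :
    KoszulVanishes (LinearMap.range φ) s (j + 1) e ↔ KoszulVanishes (LinearMap.ker φ) s' j e := by
  constructor
  · intro h f hfN hfj hfe hf
    obtain ⟨g', hg'j, hg'⟩ := exists_koszulBdry_eq j f hfj hf fun τ a _ => hker _ (hfN τ) a
    -- Acyclicity gives a primitive without control of degrees; its component of total degree e is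
    -- still a primitive of f.
    set g : Finset V → ι → MvPolynomial V K := fun τ => vecComp s' (e - τ.card) (g' τ) with hgdef
    have hgj : ∀ τ, τ.card ≠ j + 1 → g τ = 0 := fun τ hτ => by
      simp only [hgdef]; rw [hg'j τ hτ, map_zero]
    have hg : koszulBdry (K := K) g = f := by
      rw [hgdef, koszulBdry_vecComp, hg']
      exact funext fun τ => (hfe τ).vecComp_eq
    obtain ⟨q, hqN, hqj, hq⟩ := h (fun τ => φ (g τ)) (fun τ => ⟨_, rfl⟩)
      (fun τ hτ => by rw [hgj τ hτ, map_zero])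
      (fun τ => by
        have : φ (g τ) = vecComp s (e - τ.card) (φ (g' τ)) := (hφ.vecComp_apply _ _).symm
        rw [this]
        exact isVecForm_vecComp _ _ _)
      (by
        rw [koszulBdry_map, hg]
        exact funext fun τ => hfN τ)
    choose q' hq' using hqN
    set r : Finset V → ι → MvPolynomial V K := fun τ => if τ.card = j + 2 then q' τ else 0 with hr
    have hrj : ∀ τ, τ.card ≠ j + 1 + 1 → r τ = 0 := fun τ hτ => if_neg hτ
    have hφr : (fun τ => φ (r τ)) = q := by
      funext τ
      by_cases hτ : τ.card = j + 2
      · simp only [hr, if_pos hτ, hq']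
      · simp only [hr, if_neg hτ, map_zero]
        exact (hqj τ hτ).symm
    refine ⟨g - koszulBdry (K := K) r, fun τ => ?_, fun τ hτ => ?_, ?_⟩
    · have h1 := congrFun (koszulBdry_map φ r) τ
      rw [hφr, hq] at h1
      rw [LinearMap.mem_ker, Pi.sub_apply, map_sub, ← h1, sub_self]
    · rw [Pi.sub_apply, hgj τ hτ, koszulBdry_support hrj τ hτ, sub_zero]
    · rw [map_sub, koszulBdry_bdry, sub_zero, hg]
  · intro h f hfN hfj hfe hf
    choose q hq using hfN
    set p : Finset V → ι → MvPolynomial V K := fun τ => if τ.card = j + 1 then q τ else 0 with hp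
    set f' : Finset V → ι → MvPolynomial V K := fun τ => vecComp s' (e - τ.card) (p τ) with hf'def
    have hpj : ∀ τ, τ.card ≠ j + 1 → p τ = 0 := fun τ hτ => if_neg hτ
    have hf'j : ∀ τ, τ.card ≠ j + 1 → f' τ = 0 := fun τ hτ => by
      simp only [hf'def]; rw [hpj τ hτ, map_zero]
    have hφp : ∀ τ, φ (p τ) = f τ := by
      intro τ
      by_cases hτ : τ.card = j + 1
      · simp only [hp, if_pos hτ, hq]
      · simp only [hp, if_neg hτ, map_zero]
        exact (hfj τ hτ).symm
    have hφf' : ∀ τ, φ (f' τ) = f τ := by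
      intro τ
      simp only [hf'def]
      rw [← hφ.vecComp_apply, hφp, (hfe τ).vecComp_eq]
    obtain ⟨g, hgN, hgj, hg⟩ := h (koszulBdry (K := K) f')
      (fun τ => by
        have h1 := congrFun (koszulBdry_map φ f') τ
        rw [funext hφf', hf] at h1
        exact h1.symm)
      (koszulBdry_support hf'j)
      (fun τ => by
        rw [hf'def, koszulBdry_vecComp]
        exact isVecForm_vecComp _ _ _)
      (koszulBdry_bdry _)
    obtain ⟨r, hrj, hr⟩ := exists_koszulBdry_eq (j + 1) (f' - g)
      (fun τ hτ => by rw [Pi.sub_apply, hf'j τ hτ, hgj τ hτ, sub_zero])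
      (by rw [map_sub, hg, sub_self]) (fun _ _ h => absurd h (Nat.succ_ne_zero j))
    refine ⟨fun τ => φ (r τ), fun τ => ⟨_, rfl⟩, fun τ hτ => by simp only [hrj τ hτ, map_zero], ?_⟩
    rw [koszulBdry_map, hr]
    funext τ
    rw [Pi.sub_apply, map_sub, hφf', LinearMap.mem_ker.1 (hgN τ), sub_zero]

theorem koszulBdry_eq_zero_of_support {M : Type*} [AddCommGroup M] [Module (MvPolynomial V K) M]
    {f : Finset V → M} (hf : ∀ τ, τ.card ≠ 0 → f τ = 0) : koszulBdry (K := K) f = 0 := by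
  funext τ
  refine Finset.sum_eq_zero fun x hx => ?_
  rw [hf, smul_zero, smul_zero]
  rw [Finset.card_insert_of_notMem (Finset.mem_compl.1 hx)]
  omega

theorem constantCoeff_koszulBdry (g : Finset V → κ → MvPolynomial V K) (τ : Finset V) (a : κ) :
    constantCoeff (koszulBdry (K := K) g τ a) = 0 := by
  rw [koszulBdry_apply, Finset.sum_apply, map_sum]
  refine Finset.sum_eq_zero fun x _ => ?_
  rw [Pi.smul_apply, Pi.smul_apply, map_zsmul, smul_eq_mul, map_mul, constantCoeff_X, zero_mul,
    smul_zero]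

/-- H_0 of a module N is N/𝔪N, and ker φ ⊆ 𝔪F identifies it for N = range φ with F/𝔪F, whose basis
sits in the degrees `s'`. -/
theorem koszulVanishes_range_zero_iff [Nonempty V] (hφ : IsHomogMap s' s φ)
    (hker : ∀ y ∈ LinearMap.ker φ, ∀ b, constantCoeff (y b) = 0) (e : ℤ) :
    KoszulVanishes (LinearMap.range φ) s 0 e ↔ ∀ b, s' b ≠ e := by
  constructor
  · intro h b hb
    set f : Finset V → κ → MvPolynomial V K :=
      fun τ => if τ.card = 0 then φ (Pi.single b 1) else 0 with hfdef
    have hf0 : ∀ τ, τ.card ≠ 0 → f τ = 0 := fun τ hτ => if_neg hτ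
    obtain ⟨g, hgN, -, hg⟩ := h f (fun τ => by
        simp only [hfdef]; split_ifs
        · exact ⟨_, rfl⟩
        · exact Submodule.zero_mem _) hf0
      (fun τ => by
        simp only [hfdef]; split_ifs with h0
        · rw [h0, ← hb]
          intro a
          simpa using hφ b a
        · exact isVecForm_zero _ _) (koszulBdry_eq_zero_of_support hf0)
    choose g' hg' using hgN
    have h1 := congrFun (koszulBdry_map φ g') ∅
    simp only [hg'] at h1
    rw [hg] at h1
    have h2 : f ∅ = φ (Pi.single b 1) := if_pos rfl
    have h3 := hker (Pi.single b 1 - koszulBdry (K := K) g' ∅)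
      (by rw [LinearMap.mem_ker, map_sub, ← h1, h2, sub_self]) b
    rw [Pi.sub_apply, map_sub, constantCoeff_koszulBdry, Pi.single_eq_same, map_one, sub_zero] at h3
    exact one_ne_zero h3
  · intro h f hfN hfj hfe _
    obtain ⟨q, hq⟩ := hfN ∅
    set f' : Finset V → ι → MvPolynomial V K :=
      fun τ => if τ.card = 0 then vecComp s' e q else 0 with hf'def
    have hf'0 : ∀ τ, τ.card ≠ 0 → f' τ = 0 := fun τ hτ => if_neg hτ
    obtain ⟨r, hrj, hr⟩ := exists_koszulBdry_eq 0 f' hf'0 (koszulBdry_eq_zero_of_support hf'0)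
      (fun τ b _ => by
        simp only [hf'def]; split_ifs with h0
        · exact (isVecForm_vecComp s' e q b).constantCoeff_eq_zero (sub_ne_zero.2 (h b).symm)
        · exact map_zero _)
    refine ⟨fun τ => φ (r τ), fun τ => ⟨_, rfl⟩, fun τ hτ => by simp only [hrj τ hτ, map_zero], ?_⟩
    rw [koszulBdry_map, hr]
    funext τ
    by_cases hτ : τ.card = 0
    · obtain rfl := Finset.card_eq_zero.1 hτ
      have h1 := hfe ∅
      rw [Finset.card_empty, Nat.cast_zero, sub_zero] at h1
      simp only [hf'def, if_pos hτ]
      rw [← hφ.vecComp_apply, hq, h1.vecComp_eq]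
    · rw [hf'0 τ hτ, hfj τ hτ, map_zero]

namespace GradedFreeResolution

variable {I : Ideal (MvPolynomial V K)}

/-- Dimension shifting: each syzygy module passed on the way down to I raises the homological degree
by one. -/
theorem IsMinimal.koszulVanishes_range_d_iff [Nonempty V] {F : GradedFreeResolution I} (hF : F.IsMinimal)
    (i j : ℕ) (e : ℤ) : KoszulVanishes (LinearMap.range (F.d i)) (F.shift i) j e ↔
      KoszulVanishes I.toRankOne (fun _ => 0) (i + 1 + j) e := by
  induction i generalizing j with
  | zero =>
    rw [F.exact_zero, ← F.ker_augRankOne,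
      ← koszulVanishes_range_succ_iff F.isHomogMap_augRankOne hF.ker_augRankOne,
      F.range_augRankOne, show j + 1 = 0 + 1 + j by ring]
  | succ i ih =>
    rw [F.exact_succ, ← koszulVanishes_range_succ_iff (F.d_homogeneous i) (hF.ker_d i), ih,
      show i + 1 + (j + 1) = i + 1 + 1 + j by ring]

theorem IsMinimal.betti_ne_zero_iff [Nonempty V] {F : GradedFreeResolution I} (hF : F.IsMinimal) (i : ℕ)
    (e : ℤ) : F.betti i e ≠ 0 ↔ ¬ KoszulVanishes I.toRankOne (fun _ => 0) i e := by
  have h1 : F.betti i e ≠ 0 ↔ ¬ ∀ b, F.shift i b ≠ e := by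
    rw [betti, ← Nat.pos_iff_ne_zero, Finite.card_pos_iff, nonempty_subtype]
    push Not
    rfl
  rw [h1, not_iff_not]
  cases i with
  | zero =>
    rw [← F.range_augRankOne,
      koszulVanishes_range_zero_iff F.isHomogMap_augRankOne hF.ker_augRankOne]
  | succ i =>
    rw [← koszulVanishes_range_zero_iff (F.d_homogeneous i) (hF.ker_d i),
      hF.koszulVanishes_range_d_iff, add_zero]

theorem IsMinimal.regSet_eq [Nonempty V] {F : GradedFreeResolution I} (hF : F.IsMinimal) :
    F.regSet = {r | ∃ (i : ℕ) (e : ℤ),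
      ¬ KoszulVanishes I.toRankOne (fun _ => 0) i e ∧ r = e - i} := by
  ext r
  simp only [regSet, Set.mem_ofPred_eq, hF.betti_ne_zero_iff]

end GradedFreeResolution

end KoszulHomology

/-! ### Existence of minimal graded free resolutions. -/

section MinimalResolution

variable {V : Type u} {K : Type v} [Field K]

/-- A submodule of a graded free module is graded if it contains the components of its elements. -/
def IsGradedSubmodule {κ : Type*} (s : κ → ℤ)
    (N : Submodule (MvPolynomial V K) (κ → MvPolynomial V K)) : Prop :=
  ∀ e, ∀ y ∈ N, vecComp s e y ∈ N

theorem IsHomogMap.isGradedSubmodule_ker {ι κ : Type*} [DecidableEq ι] [Fintype ι] {s' : ι → ℤ}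
    {s : κ → ℤ} {φ : (ι → MvPolynomial V K) →ₗ[MvPolynomial V K] (κ → MvPolynomial V K)}
    (hφ : IsHomogMap s' s φ) : IsGradedSubmodule s' (LinearMap.ker φ) := by
  intro e y hy
  rw [LinearMap.mem_ker, ← hφ.vecComp_apply, LinearMap.mem_ker.1 hy, map_zero]

theorem exists_sum_vecComp_eq {κ : Type*} [Fintype κ] (s : κ → ℤ) (y : κ → MvPolynomial V K) :
    ∃ E : Finset ℤ, y = ∑ e ∈ E, vecComp s e y := by
  classical
  refine ⟨Finset.univ.biUnion fun a => (y a).support.image fun m => (m.degree : ℤ) + s a, ?_⟩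
  funext a
  ext m
  rw [Finset.sum_apply, coeff_sum]
  simp only [vecComp_apply, coeff_formComp, eq_sub_iff_add_eq]
  rw [Finset.sum_ite_eq]
  split_ifs with h
  · rfl
  · by_contra hne
    refine h (Finset.mem_biUnion.2 ⟨a, Finset.mem_univ a, Finset.mem_image.2 ⟨m, ?_, rfl⟩⟩)
    exact mem_support_iff.2 hne

/-- A homogeneous generating family with `n` members. -/
def HasHomogGenerators {κ : Type*} (s : κ → ℤ)
    (N : Submodule (MvPolynomial V K) (κ → MvPolynomial V K)) (n : ℕ) : Prop :=
  ∃ (w : Fin n → κ → MvPolynomial V K) (δ : Fin n → ℤ), (∀ i, IsVecForm s (δ i) (w i)) ∧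
    Submodule.span (MvPolynomial V K) (Set.range w) = N

theorem IsGradedSubmodule.exists_hasHomogGenerators [Finite V] {κ : Type*} [Fintype κ] {s : κ → ℤ}
    {N : Submodule (MvPolynomial V K) (κ → MvPolynomial V K)} (hN : IsGradedSubmodule s N) :
    ∃ n, HasHomogGenerators s N n := by
  have hspan : Submodule.span (MvPolynomial V K) {y | y ∈ N ∧ ∃ e, IsVecForm s e y} = N := by
    refine le_antisymm (Submodule.span_le.2 fun y hy => hy.1) fun y hy => ?_
    obtain ⟨E, hE⟩ := exists_sum_vecComp_eq s y
    rw [hE]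
    exact Submodule.sum_mem _ fun e _ => Submodule.subset_span
      ⟨hN e y hy, e, isVecForm_vecComp _ _ _⟩
  have hfg : (Submodule.span (MvPolynomial V K) {y | y ∈ N ∧ ∃ e, IsVecForm s e y}).FG :=
    IsNoetherian.noetherian _
  rw [Submodule.fg_span_iff_fg_span_finset_subset] at hfg
  obtain ⟨t, ht, hts⟩ := hfg
  have h : ∀ i : Fin t.card, ∃ e, IsVecForm s e (t.equivFin.symm i : κ → MvPolynomial V K) :=
    fun i => (ht (t.equivFin.symm i).2).2
  choose δ hδ using h
  refine ⟨t.card, fun i => t.equivFin.symm i, δ, hδ, ?_⟩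
  rw [← hspan, hts]
  congr 1
  ext y
  constructor
  · rintro ⟨i, rfl⟩
    exact (t.equivFin.symm i).2
  · intro hy
    exact ⟨t.equivFin ⟨y, hy⟩, by simp⟩

/-- A graded submodule of a graded free module of finite rank has a minimal presentation. -/
theorem IsGradedSubmodule.exists_minimal_generators [Finite V] {κ : Type*} [Fintype κ] {s : κ → ℤ}
    {N : Submodule (MvPolynomial V K) (κ → MvPolynomial V K)} (hN : IsGradedSubmodule s N) :
    ∃ (r : ℕ) (s' : Fin r → ℤ)
      (φ : (Fin r → MvPolynomial V K) →ₗ[MvPolynomial V K] (κ → MvPolynomial V K)),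
      IsHomogMap s' s φ ∧ LinearMap.range φ = N ∧
        ∀ y ∈ LinearMap.ker φ, ∀ b, constantCoeff (y b) = 0 := by
  classical
  have hex := hN.exists_hasHomogGenerators
  obtain ⟨w, δ, hw, hspan⟩ := Nat.find_spec hex
  have hmin : ∀ m, m < Nat.find hex → ¬ HasHomogGenerators s N m := fun m => Nat.find_min hex
  generalize Nat.find hex = n at *
  have hsingle : ∀ b, Fintype.linearCombination (MvPolynomial V K) w (Pi.single b 1) = w b := by
    intro b
    rw [Fintype.linearCombination_apply_single, one_smul]
  have hφ : IsHomogMap δ s (Fintype.linearCombination (MvPolynomial V K) w) := by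
    intro b a
    rw [hsingle]
    exact hw b a
  refine ⟨n, δ, Fintype.linearCombination (MvPolynomial V K) w, hφ, ?_, ?_⟩
  · rw [Fintype.range_linearCombination, hspan]
  · intro y hy b
    by_contra hc
    -- The component of the relation y in degree δ b has a nonzero scalar as its coefficient at b,
    -- so the generator `w b` is redundant, against the minimality of n.
    have hy' := hφ.isGradedSubmodule_ker (δ b) y hy
    have hyb : vecComp δ (δ b) y b = C (constantCoeff (y b)) := by
      ext m
      rw [vecComp_apply, coeff_formComp, coeff_C, sub_self]
      by_cases hm : m = 0
      · subst hm; simp [constantCoeff_eq]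
      · rw [if_neg (Ne.symm hm), if_neg]
        rw [Nat.cast_eq_zero, Finsupp.degree_eq_zero_iff]
        exact hm
    rw [LinearMap.mem_ker, Fintype.linearCombination_apply] at hy'
    obtain ⟨m, rfl⟩ : ∃ m, n = m + 1 := ⟨n - 1, by have := b.pos; omega⟩
    rw [Fin.sum_univ_succAbove _ b, hyb] at hy'
    refine hmin m (Nat.lt_succ_self m) ⟨fun i => w (b.succAbove i), fun i => δ (b.succAbove i),
      fun i => hw _, ?_⟩
    refine le_antisymm ?_ ?_
    · rw [← hspan]
      refine Submodule.span_mono ?_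
      rintro _ ⟨i, rfl⟩
      exact ⟨_, rfl⟩
    · rw [← hspan, Submodule.span_le]
      have hmem : ∀ i, w (b.succAbove i) ∈ Submodule.span (MvPolynomial V K)
          (Set.range fun i => w (b.succAbove i)) := fun i => Submodule.subset_span ⟨i, rfl⟩
      rintro _ ⟨i, rfl⟩
      rcases Fin.eq_self_or_eq_succAbove b i with rfl | ⟨j, rfl⟩
      · have h1 : w i = (C (constantCoeff (y i))⁻¹ : MvPolynomial V K) •
            (C (constantCoeff (y i)) : MvPolynomial V K) • w i := by
          rw [smul_smul, ← C_mul, inv_mul_cancel₀ hc, C_1, one_smul]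
        rw [SetLike.mem_coe, h1, eq_neg_of_add_eq_zero_left hy']
        exact Submodule.smul_mem _ _ (Submodule.neg_mem _
          (Submodule.sum_mem _ fun j _ => Submodule.smul_mem _ _ (hmem j)))
      · exact hmem j

variable (V K) in
/-- A graded submodule of a graded free module of finite rank. -/
structure GradedSubmodule where
  /-- the rank of the free module -/
  rank : ℕ
  /-- the degrees of the basis elements -/
  shift : Fin rank → ℤ
  /-- the submodule -/
  carrier : Submodule (MvPolynomial V K) (Fin rank → MvPolynomial V K)
  isGraded : IsGradedSubmodule shift carrier

namespace GradedSubmodule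

variable [Finite V]

/-- The module of syzygies of a minimal system of homogeneous generators. -/
noncomputable def syzygy (A : GradedSubmodule V K) : GradedSubmodule V K where
  rank := A.isGraded.exists_minimal_generators.choose
  shift := A.isGraded.exists_minimal_generators.choose_spec.choose
  carrier := LinearMap.ker A.isGraded.exists_minimal_generators.choose_spec.choose_spec.choose
  isGraded :=
    A.isGraded.exists_minimal_generators.choose_spec.choose_spec.choose_spec.1.isGradedSubmodule_ker

/-- The map onto a graded submodule given by a minimal system of homogeneous generators. -/
noncomputable def cover (A : GradedSubmodule V K) :
    (Fin A.syzygy.rank → MvPolynomial V K) →ₗ[MvPolynomial V K] (Fin A.rank → MvPolynomial V K) :=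
  A.isGraded.exists_minimal_generators.choose_spec.choose_spec.choose

theorem isHomogMap_cover (A : GradedSubmodule V K) :
    IsHomogMap A.syzygy.shift A.shift A.cover :=
  A.isGraded.exists_minimal_generators.choose_spec.choose_spec.choose_spec.1

theorem range_cover (A : GradedSubmodule V K) : LinearMap.range A.cover = A.carrier :=
  A.isGraded.exists_minimal_generators.choose_spec.choose_spec.choose_spec.2.1

theorem constantCoeff_eq_zero (A : GradedSubmodule V K) :
    ∀ y ∈ A.syzygy.carrier, ∀ b, constantCoeff (y b) = 0 :=
  A.isGraded.exists_minimal_generators.choose_spec.choose_spec.choose_spec.2.2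

/-- The iterated syzygies. -/
noncomputable def syzygies (A : GradedSubmodule V K) : ℕ → GradedSubmodule V K
  | 0 => A
  | i + 1 => (A.syzygies i).syzygy

end GradedSubmodule

theorem exists_isMinimal_gradedFreeResolution [Finite V] {I : Ideal (MvPolynomial V K)}
    (hI : ∀ e, ∀ p ∈ I, formComp e p ∈ I) : ∃ F : GradedFreeResolution I, F.IsMinimal := by
  have hgr : IsGradedSubmodule (fun _ => 0) I.toRankOne := fun e y hy => hI _ _ hy
  obtain ⟨r, s, φ, hφ, hrange, hker⟩ := hgr.exists_minimal_generators
  -- The recursion starts at the first syzygy module inside F 0, so that `A.syzygies i` lies in F i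
  -- and is the image of F (i + 1).
  let A : GradedSubmodule V K := ⟨r, s, LinearMap.ker φ, hφ.isGradedSubmodule_ker⟩
  have hmem : ∀ i, ∀ y ∈ (A.syzygies i).carrier, ∀ b, constantCoeff (y b) = 0 := by
    intro i
    cases i with
    | zero => exact hker
    | succ i => exact (A.syzygies i).constantCoeff_eq_zero
  refine ⟨{ rank := fun i => (A.syzygies i).rank
            shift := fun i => (A.syzygies i).shift
            aug := LinearMap.proj () ∘ₗ φ
            d := fun i => (A.syzygies i).cover
            aug_homogeneous := fun b => by
              have := hφ b ()
              rw [sub_zero] at this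
              exact this
            d_homogeneous := fun i => (A.syzygies i).isHomogMap_cover
            range_aug := ?_
            exact_zero := ?_
            exact_succ := fun i => (A.syzygies (i + 1)).range_cover }, ?_⟩
  · ext p
    have h1 : p ∈ I ↔ (fun _ => p) ∈ LinearMap.range φ := by rw [hrange]; rfl
    rw [h1]
    constructor
    · rintro ⟨z, rfl⟩
      exact ⟨z, rfl⟩
    · rintro ⟨z, hz⟩
      exact ⟨z, congrFun hz ()⟩
  · refine (A.syzygies 0).range_cover.trans ?_
    ext y
    change φ y = 0 ↔ φ y () = 0
    exact ⟨fun h => by rw [h]; rfl, fun h => funext fun _ => h⟩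
  · intro i b a
    refine hmem i _ ?_ a
    have h := (A.syzygies i).range_cover
    rw [← h]
    exact ⟨_, rfl⟩

end MinimalResolution

/-! ### Symbolic powers of the cover ideal as monomial conditions on edges. -/

section SymbolicPower

theorem mem_symbolicPower {R : Type u} [CommRing R] {I : Ideal R} {k : ℕ} {f : R} :
    f ∈ symbolicPower I k ↔ ∀ 𝔭 ∈ I.minimalPrimes, ∃ s ∉ 𝔭, s * f ∈ I ^ k := by
  rw [symbolicPower, Submodule.mem_iInf, Subtype.forall]
  refine forall₂_congr fun 𝔭 h𝔭 => ?_
  have : 𝔭.IsPrime := h𝔭.1.1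
  rw [LinearMap.mem_ker, LinearMap.comp_apply, IsLocalizedModule.eq_zero_iff 𝔭.primeCompl]
  constructor
  · rintro ⟨⟨s, hs⟩, h⟩
    refine ⟨s, hs, ?_⟩
    rw [Submonoid.mk_smul, ← map_smul, Submodule.mkQ_apply, Submodule.Quotient.mk_eq_zero] at h
    exact h
  · rintro ⟨s, hs, h⟩
    have hs' : s ∈ 𝔭.primeCompl := hs
    refine ⟨⟨s, hs'⟩, ?_⟩
    rw [Submonoid.mk_smul, ← map_smul, Submodule.mkQ_apply, Submodule.Quotient.mk_eq_zero]
    exact h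

variable {V : Type u} {K : Type v} [Field K]

open Classical in
/-- The homomorphism multiplying the variables `x` and `y` by a parameter. -/
noncomputable def edgeScaling (K : Type v) [Field K] (x y : V) :
    MvPolynomial V K →ₐ[K] Polynomial (MvPolynomial V K) :=
  aeval fun z => Polynomial.C (X z) * Polynomial.X ^ (if z = x ∨ z = y then 1 else 0)

theorem edgeScaling_monomial {x y : V} (hxy : x ≠ y) (m : V →₀ ℕ) (c : K) :
    edgeScaling K x y (monomial m c) = Polynomial.monomial (m x + m y) (monomial m c) := by
  classical
  have h1 : (m.sum fun z n => (if z = x ∨ z = y then 1 else 0) * n) = m x + m y := by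
    have h2 : (m.sum fun z n => (if z = x ∨ z = y then 1 else 0) * n) =
        (m.sum fun z n => if x = z then n else 0) + m.sum fun z n => if y = z then n else 0 := by
      rw [← Finsupp.sum_add]
      refine Finsupp.sum_congr fun z _ => ?_
      by_cases hx : x = z <;> by_cases hy : y = z <;> simp_all [eq_comm]
    rw [h2, Finsupp.sum_ite_self_eq, Finsupp.sum_ite_self_eq]
  rw [edgeScaling, aeval_monomial]
  simp only [mul_pow, ← pow_mul]
  rw [Finsupp.prod_mul, Finsupp.prod, Finsupp.prod, Finset.prod_pow_eq_pow_sum]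
  have h3 : ∑ i ∈ m.support, (if i = x ∨ i = y then 1 else 0) * m i = m x + m y := h1
  rw [h3, ← Polynomial.C_mul_X_pow_eq_monomial, ← mul_assoc]
  congr 1
  rw [monomial_eq, Polynomial.C_mul, Finsupp.prod, map_prod]
  simp only [map_pow]
  rfl

theorem coeff_coeff_edgeScaling {x y : V} (hxy : x ≠ y) (f : MvPolynomial V K) (n : ℕ)
    (m : V →₀ ℕ) :
    coeff m ((edgeScaling K x y f).coeff n) = if m x + m y = n then coeff m f else 0 := by
  classical
  induction f using MvPolynomial.induction_on' with
  | monomial m' c =>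
    rw [edgeScaling_monomial hxy, Polynomial.coeff_monomial]
    by_cases h : m' = m
    · subst h
      split_ifs <;> simp
    · split_ifs <;> simp [coeff_monomial, h]
  | add p q hp hq =>
    rw [map_add, Polynomial.coeff_add, coeff_add, hp, hq, coeff_add]
    split_ifs <;> simp

/-- This reads off the order of f along x = y = 0 as divisibility by powers of the parameter. As the
parameter is a prime element, edge ideals are prime and factors outside them can be cancelled. -/
theorem X_pow_dvd_edgeScaling_iff {x y : V} (hxy : x ≠ y) (f : MvPolynomial V K) (k : ℕ) :
    Polynomial.X ^ k ∣ edgeScaling K x y f ↔ ∀ m ∈ f.support, k ≤ m x + m y := by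
  rw [Polynomial.X_pow_dvd_iff]
  constructor
  · intro h m hm
    by_contra hlt
    have := coeff_coeff_edgeScaling hxy f (m x + m y) m
    rw [h _ (not_le.1 hlt), if_pos rfl, coeff_zero] at this
    exact mem_support_iff.1 hm this.symm
  · intro h n hn
    ext m
    rw [coeff_coeff_edgeScaling hxy, coeff_zero]
    split_ifs with he
    · by_contra hc
      have := h m (mem_support_iff.2 hc)
      omega
    · rfl

/-- The ideal generated by two variables. -/
noncomputable def edgePrime (K : Type v) [Field K] (x y : V) : Ideal (MvPolynomial V K) :=
  Ideal.span (X '' {x, y})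

theorem mem_edgePrime {x y : V} {f : MvPolynomial V K} :
    f ∈ edgePrime K x y ↔ ∀ m ∈ f.support, 1 ≤ m x + m y := by
  rw [edgePrime, mem_ideal_span_X_image]
  refine forall₂_congr fun m _ => ?_
  simp only [Set.mem_insert_iff, Set.mem_singleton_iff, exists_eq_or_imp, exists_eq_left]
  omega

theorem edgePrime_isPrime {x y : V} (hxy : x ≠ y) : (edgePrime K x y).IsPrime := by
  have h : edgePrime K x y = Ideal.comap (edgeScaling K x y) (Ideal.span {Polynomial.X}) := by
    ext f
    rw [mem_edgePrime, Ideal.mem_comap, Ideal.mem_span_singleton, ← pow_one Polynomial.X,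
      X_pow_dvd_edgeScaling_iff hxy]
  have : (Ideal.span {(Polynomial.X : Polynomial (MvPolynomial V K))}).IsPrime :=
    (Ideal.span_singleton_prime Polynomial.X_ne_zero).2 Polynomial.prime_X
  rw [h]
  exact Ideal.comap_isPrime _ _

theorem edgePrime_le_iff {x y : V} {q : Ideal (MvPolynomial V K)} :
    edgePrime K x y ≤ q ↔ X x ∈ q ∧ X y ∈ q := by
  rw [edgePrime, Ideal.span_le, Set.image_pair, Set.insert_subset_iff, Set.singleton_subset_iff]
  rfl

theorem X_mem_edgePrime_iff {x y z : V} :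
    (X z : MvPolynomial V K) ∈ edgePrime K x y ↔ z = x ∨ z = y := by
  classical
  rw [mem_edgePrime]
  simp only [support_X, Finset.mem_singleton, forall_eq, Finsupp.single_apply]
  split_ifs <;> simp_all

theorem prod_X_eq_monomial (C : Finset V) :
    ∏ x ∈ C, (X x : MvPolynomial V K) = monomial (setExp C) 1 := by
  rw [setExp, monomial_sum_one]; rfl

/-- The exponent vectors of weight at least `k` along every edge. -/
def SimpleGraph.coverExponents (G : SimpleGraph V) (k : ℕ) : Set (V →₀ ℕ) :=
  {m | ∀ x y, G.Adj x y → k ≤ m x + m y}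

variable {G : SimpleGraph V}

theorem SimpleGraph.exists_isMinimalVertexCover_subset {C : Finset V}
    (hC : G.IsVertexCover (C : Set V)) : ∃ D ⊆ C, G.IsMinimalVertexCover D := by
  obtain ⟨D, hD, hD'⟩ := exists_minimal_le_of_wellFoundedLT
    (fun D : Finset V => G.IsVertexCover (D : Set V)) C hC
  exact ⟨D, hD, hD'⟩

theorem SimpleGraph.IsVertexCover.prod_X_mem_coverIdeal {C : Finset V}
    (hC : G.IsVertexCover (C : Set V)) : ∏ x ∈ C, X x ∈ G.coverIdeal K := by
  obtain ⟨D, hDC, hD⟩ := G.exists_isMinimalVertexCover_subset hC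
  exact Ideal.mem_of_dvd _ (Finset.prod_dvd_prod_of_subset _ _ _ hDC)
    (Ideal.subset_span ⟨D, hD, rfl⟩)

theorem SimpleGraph.coverIdeal_le_edgePrime {x y : V} (h : G.Adj x y) :
    G.coverIdeal K ≤ edgePrime K x y := by
  rw [SimpleGraph.coverIdeal, Ideal.span_le]
  rintro _ ⟨C, hC, rfl⟩
  rcases hC.1 h with hx | hx
  · exact Ideal.mem_of_dvd _ (Finset.dvd_prod_of_mem _ hx) (X_mem_edgePrime_iff.2 (Or.inl rfl))
  · exact Ideal.mem_of_dvd _ (Finset.dvd_prod_of_mem _ hx) (X_mem_edgePrime_iff.2 (Or.inr rfl))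

/-- Otherwise the variables outside q form a vertex cover, whose product lies in the cover ideal and
hence in q, although none of its factors does. -/
theorem SimpleGraph.exists_edgePrime_le [Fintype V] {q : Ideal (MvPolynomial V K)} (hq : q.IsPrime)
    (h : G.coverIdeal K ≤ q) : ∃ x y, G.Adj x y ∧ edgePrime K x y ≤ q := by
  classical
  by_contra hcon
  push Not at hcon
  have hcov : G.IsVertexCover
      ((Finset.univ.filter fun x => (X x : MvPolynomial V K) ∉ q : Finset V) : Set V) := by
    intro x y e
    have := hcon x y e
    rw [edgePrime_le_iff] at this
    simp only [Finset.coe_filter, Finset.mem_univ, true_and, Set.mem_ofPred_eq]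
    tauto
  have hmem := h (hcov.prod_X_mem_coverIdeal (K := K))
  rw [hq.prod_mem_iff] at hmem
  obtain ⟨x, hx, hxq⟩ := hmem
  exact (Finset.mem_filter.1 hx).2 hxq

theorem SimpleGraph.mem_minimalPrimes_coverIdeal_iff [Fintype V] {q : Ideal (MvPolynomial V K)} :
    q ∈ (G.coverIdeal K).minimalPrimes ↔ ∃ x y, G.Adj x y ∧ q = edgePrime K x y := by
  constructor
  · intro hq
    obtain ⟨x, y, e, hle⟩ := G.exists_edgePrime_le hq.1.1 hq.1.2
    exact ⟨x, y, e, le_antisymm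
      (hq.2 ⟨edgePrime_isPrime e.ne, G.coverIdeal_le_edgePrime e⟩ hle) hle⟩
  · rintro ⟨x, y, e, rfl⟩
    refine ⟨⟨edgePrime_isPrime e.ne, G.coverIdeal_le_edgePrime e⟩, ?_⟩
    rintro q ⟨hq, hJ⟩ hle
    obtain ⟨x', y', e', hle'⟩ := G.exists_edgePrime_le hq hJ
    refine le_trans ?_ hle'
    have h1 := edgePrime_le_iff.1 (hle'.trans hle)
    rw [X_mem_edgePrime_iff, X_mem_edgePrime_iff] at h1
    have hne := e'.ne
    rw [edgePrime_le_iff, X_mem_edgePrime_iff, X_mem_edgePrime_iff]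
    rcases h1 with ⟨rfl | rfl, rfl | rfl⟩ <;> simp_all

/-- Omitting a single vertex leaves a vertex cover. With u the product of the variables other than x
and y, both xu and yu lie in the cover ideal, so u^k x^p y^q = (xu)^p (yu)^q lies in its k-th power
when p + q = k. -/
theorem SimpleGraph.prod_pow_mul_monomial_mem [Fintype V] [DecidableEq V] {x y : V}
    (hxy : G.Adj x y) {k : ℕ} {m : V →₀ ℕ} (hm : k ≤ m x + m y) (c : K) :
    (∏ z ∈ {x, y}ᶜ, X z) ^ k * monomial m c ∈ G.coverIdeal K ^ k := by
  obtain ⟨p, q, hp, hq, rfl⟩ : ∃ p q, p ≤ m x ∧ q ≤ m y ∧ p + q = k :=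
    ⟨min k (m x), k - min k (m x), by omega, by omega, by omega⟩
  have hle : Finsupp.single x p + Finsupp.single y q ≤ m := by
    intro z
    rw [Finsupp.add_apply, Finsupp.single_apply, Finsupp.single_apply]
    have := hxy.ne
    by_cases hx : x = z <;> by_cases hy : y = z <;> simp_all
  have hfac : monomial m c = X x ^ p * X y ^ q *
      monomial (m - (Finsupp.single x p + Finsupp.single y q)) c := by
    rw [X_pow_eq_monomial, X_pow_eq_monomial, monomial_mul, monomial_mul, one_mul, one_mul,
      add_tsub_cancel_of_le hle]
  have hcov : ∀ a b : V, G.Adj a b → {a, b} = ({x, y} : Finset V) →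
      X a * ∏ z ∈ {x, y}ᶜ, X z ∈ G.coverIdeal K := by
    intro a b hab h
    rw [← h, ← Finset.prod_insert (f := fun z => (X z : MvPolynomial V K)) (by simp)]
    refine SimpleGraph.IsVertexCover.prod_X_mem_coverIdeal ?_
    intro v w e
    have := e.ne
    simp only [Finset.coe_insert, Set.mem_insert_iff, Finset.mem_coe, Finset.mem_compl,
      Finset.mem_insert, Finset.mem_singleton]
    by_cases h1 : v = b
    · subst h1
      by_cases h2 : w = a <;> simp_all [eq_comm]
    · by_cases h2 : v = a <;> simp_all
  have h1 := Ideal.pow_mem_pow (hcov x y hxy rfl) p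
  have h2 := Ideal.pow_mem_pow (hcov y x hxy.symm (Finset.pair_comm _ _)) q
  have h3 := Ideal.mul_mem_mul h1 h2
  rw [← pow_add] at h3
  have h4 := Ideal.mul_mem_right
    (monomial (m - (Finsupp.single x p + Finsupp.single y q)) c) _ h3
  rw [hfac]
  convert h4 using 1
  ring

/-- The minimal primes are the edge primes. The order along an edge is at least k on the k-th power
and zero on multipliers outside the prime; conversely, a power of the product of the remaining
variables is a suitable multiplier. -/
theorem SimpleGraph.mem_symbolicPower_coverIdeal [Fintype V] {k : ℕ} {f : MvPolynomial V K} :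
    f ∈ symbolicPower (G.coverIdeal K) k ↔ ∀ m ∈ f.support, m ∈ G.coverExponents k := by
  rw [mem_symbolicPower]
  constructor
  · intro h m hm x y e
    obtain ⟨s, hs, hsf⟩ := h _ (G.mem_minimalPrimes_coverIdeal_iff.2 ⟨x, y, e, rfl⟩)
    have hle : G.coverIdeal K ≤ Ideal.comap (edgeScaling K x y) (Ideal.span {Polynomial.X}) := by
      intro g hg
      rw [Ideal.mem_comap, Ideal.mem_span_singleton, ← pow_one Polynomial.X,
        X_pow_dvd_edgeScaling_iff e.ne]
      exact mem_edgePrime.1 (G.coverIdeal_le_edgePrime e hg)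
    have h1 := Ideal.le_comap_pow (edgeScaling K x y) k (Ideal.pow_right_mono hle k hsf)
    rw [Ideal.mem_comap, Ideal.span_singleton_pow, Ideal.mem_span_singleton, map_mul] at h1
    have h2 : ¬ Polynomial.X ∣ edgeScaling K x y s := by
      rw [← pow_one Polynomial.X, X_pow_dvd_edgeScaling_iff e.ne, ← mem_edgePrime]
      exact hs
    exact (X_pow_dvd_edgeScaling_iff e.ne f k).1
      (Polynomial.prime_X.pow_dvd_of_dvd_mul_left k h2 h1) m hm
  · intro h q hq
    classical
    obtain ⟨x, y, e, rfl⟩ := G.mem_minimalPrimes_coverIdeal_iff.1 hq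
    have hp := edgePrime_isPrime (K := K) e.ne
    refine ⟨(∏ z ∈ {x, y}ᶜ, X z) ^ k, fun hs => ?_, ?_⟩
    · have hs' := hp.mem_of_pow_mem k hs
      rw [hp.prod_mem_iff] at hs'
      obtain ⟨z, hz, hzp⟩ := hs'
      rw [X_mem_edgePrime_iff] at hzp
      simp at hz
      tauto
    · rw [f.as_sum, Finset.mul_sum]
      exact Ideal.sum_mem _ fun m hm => SimpleGraph.prod_pow_mul_monomial_mem e (h m hm x y e) _

theorem setExp_le_iff {C : Finset V} {m : V →₀ ℕ} : setExp C ≤ m ↔ ∀ x ∈ C, 1 ≤ m x := by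
  classical
  constructor
  · intro h x hx
    have := h x
    rwa [setExp_apply, if_pos hx] at this
  · intro h x
    rw [setExp_apply]
    split_ifs with hx
    · exact h x hx
    · exact Nat.zero_le _

theorem setExp_le_setExp_iff {C D : Finset V} : setExp C ≤ setExp D ↔ C ⊆ D := by
  classical
  rw [setExp_le_iff]
  refine forall₂_congr fun x _ => ?_
  rw [setExp_apply]
  split_ifs with h <;> simp [h]

theorem SimpleGraph.monomial_mem_coverIdeal_iff {m : V →₀ ℕ} :
    monomial m (1 : K) ∈ G.coverIdeal K ↔ ∃ C, G.IsMinimalVertexCover C ∧ setExp C ≤ m := by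
  have h : {p : MvPolynomial V K | ∃ C : Finset V, G.IsMinimalVertexCover C ∧
      p = ∏ x ∈ C, X x} = (fun s => monomial s 1) '' (setExp '' {C | G.IsMinimalVertexCover C}) := by
    ext p
    simp only [prod_X_eq_monomial]
    constructor
    · rintro ⟨C, hC, rfl⟩
      exact ⟨_, ⟨C, hC, rfl⟩, rfl⟩
    · rintro ⟨_, ⟨C, hC, rfl⟩, rfl⟩
      exact ⟨C, hC, rfl⟩
  rw [SimpleGraph.coverIdeal, h, mem_ideal_span_monomial_image]
  classical
  simp [support_monomial]

theorem SimpleGraph.minimalMonomials_coverIdeal :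
    minimalMonomials (G.coverIdeal K) = setExp '' {C | G.IsMinimalVertexCover C} := by
  ext m
  simp only [minimalMonomials, Set.mem_ofPred_eq, Set.mem_image,
    SimpleGraph.monomial_mem_coverIdeal_iff]
  constructor
  · rintro ⟨⟨C, hC, hle⟩, hmin⟩
    exact ⟨C, hC, le_antisymm hle (hmin ⟨C, hC, le_rfl⟩ hle)⟩
  · rintro ⟨C, hC, rfl⟩
    refine ⟨⟨C, hC, le_rfl⟩, ?_⟩
    rintro m ⟨D, hD, hDm⟩ hle
    exact (setExp_le_setExp_iff.2 (hC.2 hD.1 (setExp_le_setExp_iff.1 (hDm.trans hle)))).trans hDm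

theorem SimpleGraph.IsUnmixed.idealDeg_coverIdeal (hG : G.IsUnmixed) {C : Finset V}
    (hC : G.IsMinimalVertexCover C) : idealDeg (G.coverIdeal K) = C.card := by
  have h : Finsupp.degree '' minimalMonomials (G.coverIdeal K) = {C.card} := by
    rw [SimpleGraph.minimalMonomials_coverIdeal]
    ext n
    simp only [Set.mem_image, Set.mem_singleton_iff, exists_exists_and_eq_and, setExp_degree]
    constructor
    · rintro ⟨D, hD, rfl⟩
      exact hG D C hD hC
    · rintro rfl
      exact ⟨C, hC, rfl⟩
  rw [idealDeg, h, csSup_singleton]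

theorem SimpleGraph.Indep.isMinimalVertexCover_compl [Fintype V] [DecidableEq V] {M : Finset V}
    (hM : Maximal G.Indep M) : G.IsMinimalVertexCover Mᶜ := by
  constructor
  · intro x y e
    by_contra hc
    simp only [Finset.coe_compl, Set.mem_compl_iff, Finset.mem_coe, not_or, not_not] at hc
    exact hM.1 x hc.1 y hc.2 e
  · intro D hD hle
    have h1 : G.Indep Dᶜ := by
      intro x hx y hy e
      rw [Finset.mem_compl] at hx hy
      exact (hD e).elim hx hy
    have h2 : M ⊆ Dᶜ := by
      rw [Finset.subset_compl_comm]; exact hle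
    have h3 := hM.2 h1 h2
    intro x hx
    by_contra hxD
    exact Finset.mem_compl.1 hx (h3 (Finset.mem_compl.2 hxD))

end SymbolicPower

/-! ### Koszul homology of the symbolic powers: vanishing and nonvanishing. -/

section CoverIdealRegularity

theorem SimpleGraph.formComp_mem_symbolicPower_coverIdeal {V : Type u} [Fintype V] {K : Type v}
    [Field K] (G : SimpleGraph V) (k : ℕ) (e : ℤ) {p : MvPolynomial V K}
    (hp : p ∈ symbolicPower (G.coverIdeal K) k) :
    formComp e p ∈ symbolicPower (G.coverIdeal K) k := by
  rw [SimpleGraph.mem_symbolicPower_coverIdeal] at hp ⊢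
  intro m hm
  rw [mem_support_iff, coeff_formComp] at hm
  split_ifs at hm with h
  · exact hp m (mem_support_iff.2 hm)
  · exact absurd rfl hm

theorem SimpleGraph.exists_adj_of_sub_single_notMem {V : Type u} {G : SimpleGraph V} {k : ℕ}
    {m : V →₀ ℕ} (hm : m ∈ G.coverExponents k) {x : V} (hx : 1 ≤ m x)
    (h : m - Finsupp.single x 1 ∉ G.coverExponents k) : ∃ y, G.Adj x y ∧ m x + m y = k := by
  classical
  simp only [SimpleGraph.coverExponents, Set.mem_ofPred_eq, not_forall, not_le] at h
  obtain ⟨y, z, e, hlt⟩ := h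
  have hne := e.ne
  have hle := hm y z e
  have hle' := hm z y e.symm
  simp only [Finsupp.coe_tsub, Pi.sub_apply, Finsupp.single_apply] at hlt
  by_cases h1 : x = y
  · subst h1
    rw [if_pos rfl, if_neg hne] at hlt
    exact ⟨z, e, by omega⟩
  · rw [if_neg h1] at hlt
    by_cases h2 : x = z
    · subst h2
      rw [if_pos rfl] at hlt
      exact ⟨y, e.symm, by omega⟩
    · rw [if_neg h2] at hlt
      omega

variable {V : Type u} [LinearOrder V] [Fintype V] {K : Type v} [Field K]
  {G : SimpleGraph V}

/-- A multidegree b without a cone vertex would be a critical k-cover of total weight e, which is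
too heavy. -/
theorem SimpleGraph.koszulVanishes_symbolicPower_coverIdeal [Nonempty V] {a d k : ℕ}
    (had : a + d = Fintype.card V) (hα : ∀ M : Finset V, Maximal G.Indep M → M.card = a)
    (hk : 1 ≤ k) {i : ℕ} {e : ℤ} (he : ((k : ℤ) - 1) * d + Fintype.card V - 1 < e - i) :
    KoszulVanishes (symbolicPower (G.coverIdeal K) k).toRankOne (fun _ => 0) i e := by
  intro f hfI hfi hfe hf
  have hfP : ∀ τ, ∀ m ∈ (f τ ()).support, m ∈ G.coverExponents k := fun τ =>
    SimpleGraph.mem_symbolicPower_coverIdeal.1 (hfI τ)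
  have hf0 := koszulBdry_map (LinearMap.proj (R := MvPolynomial V K)
        (φ := fun _ => MvPolynomial V K) ()) f
  rw [hf] at hf0
  obtain ⟨g, hgP, hgi, hg⟩ := exists_koszulBdry_eq_of_cone (G.coverExponents k) i
    (fun τ => f τ ()) hfP (fun τ hτ => by simp only [hfi τ hτ, Pi.zero_apply]) hf0 (by
    intro τ hτ m hm
    by_contra hcon
    push Not at hcon
    set b := m + setExp τ with hb
    have hbk : ∀ x y, G.Adj x y → k ≤ b x + b y := by
      intro x y hxy
      have := hfP τ m hm x y hxy
      simp only [hb, Finsupp.add_apply]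
      omega
    have hsum : ((∑ x, b x : ℕ) : ℤ) = e := by
      have h1 := hfe τ () m hm
      rw [← Finsupp.degree_eq_sum, hb, map_add, setExp_degree]
      push_cast
      rw [h1]; ring
    have hk1 : ((k - 1 : ℕ) : ℤ) = (k : ℤ) - 1 := by omega
    have htight : ∀ x, 1 ≤ b x → ∃ σ : Finset V, σ.card = i ∧ ∃ y, G.Adj x y ∧
        b x + b y = k + setExp σ y ∧ setExp σ y ≤ b y ∧ ∀ z, G.Adj y z →
          k + setExp σ y ≤ b y + b z := by
      intro x hx
      -- As x is not a cone vertex, some m' = b - σ with x ∉ σ is admissible but cannot be lowered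
      -- at x, so an edge xy has m'-weight k. Its b-weight is k or k + 1 according to whether y ∈ σ.
      obtain ⟨σ, m', hσ, hxσ, hm'b, hm'P, hm'⟩ := hcon x
      have hval : ∀ y, b y = m' y + setExp σ y := fun y => by rw [← hm'b, Finsupp.add_apply]
      have hx' : b x = m' x := by rw [hval, setExp_apply, if_neg hxσ, add_zero]
      obtain ⟨y, hxy, h⟩ := SimpleGraph.exists_adj_of_sub_single_notMem hm'P (hx' ▸ hx)
        (hm' (hx' ▸ hx))
      refine ⟨σ, hσ, y, hxy, ?_, ?_, fun z hz => ?_⟩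
      · rw [hx', hval y]; omega
      · rw [hval y]; omega
      · have := hm'P y z hz
        rw [hval y, hval z]; omega
    -- For i ≥ 1 the weak bound e ≤ (k - 1)d + n contradicts `he`. For i = 0 strictness is needed;
    -- there σ is empty and all critical edges have weight exactly k.
    rcases Nat.eq_zero_or_pos i with rfl | hi
    · have := SimpleGraph.sum_lt_of_tight had hα hk hbk (by
        intro x hx
        obtain ⟨σ, hσ, y, hxy, h, -, -⟩ := htight x hx
        rw [Finset.card_eq_zero] at hσ
        subst hσ
        exact ⟨y, hxy, by simpa [setExp_apply] using h⟩)
      zify at this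
      rw [hk1] at this
      push_cast at hsum he
      omega
    · have hcrit : G.IsCriticalCover k b := by
        refine ⟨hbk, fun x hx => ?_⟩
        obtain ⟨σ, hσ, y, hxy, h, hy, hz⟩ := htight x hx
        rw [setExp_apply] at h hy
        simp only [setExp_apply] at hz
        refine ⟨y, hxy, ?_⟩
        split_ifs at h hy hz
        · exact Or.inr ⟨h, hy, hz⟩
        · exact Or.inl h
      have hle := hcrit.sum_le had hα hk
      have hc : (Finset.univ.filter fun x => 1 ≤ b x).card ≤ Fintype.card V :=
        Finset.card_le_univ _
      have := hle.trans (Nat.add_le_add_left hc _)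
      zify at this
      rw [hk1] at this
      push_cast at hsum
      omega)
  refine ⟨fun τ _ => g τ, fun τ => ?_, fun τ hτ => ?_, ?_⟩
  · exact SimpleGraph.mem_symbolicPower_coverIdeal.2 (hgP τ)
  · simp only [hgi τ hτ]; rfl
  · funext τ u
    have := koszulBdry_map (LinearMap.proj (R := MvPolynomial V K)
        (φ := fun _ => MvPolynomial V K) ()) (fun τ (_ : Unit) => g τ)
    exact (congrFun this τ).symm.trans (congrFun hg τ)

/-- The class of the k-th power of the monomial of C in H_0 is nonzero: by minimality each x ∈ C has
a neighbour outside C, and the edge joining them has weight exactly k, so no variable can be divided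
out. -/
theorem SimpleGraph.not_koszulVanishes_symbolicPower_coverIdeal {C : Finset V}
    (hC : G.IsMinimalVertexCover C) (k : ℕ) (hk : 1 ≤ k) :
    ¬ KoszulVanishes (symbolicPower (G.coverIdeal K) k).toRankOne (fun _ => 0) 0
      ((k : ℤ) * C.card) := by
  intro hv
  set m₀ : V →₀ ℕ := k • setExp C with hm₀
  have hval : ∀ x, m₀ x = if x ∈ C then k else 0 := by
    intro x
    rw [hm₀, Finsupp.smul_apply, setExp_apply]
    split_ifs <;> simp
  have hmem : monomial m₀ (1 : K) ∈ symbolicPower (G.coverIdeal K) k := by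
    rw [SimpleGraph.mem_symbolicPower_coverIdeal]
    intro m hm x y hxy
    rw [Finset.mem_singleton.1 (support_monomial_subset hm), hval, hval]
    rcases hC.1 hxy with h | h
    · rw [if_pos (by exact_mod_cast h)]; omega
    · rw [if_pos (c := y ∈ C) (by exact_mod_cast h)]; omega
  set f : Finset V → Unit → MvPolynomial V K :=
    fun τ => if τ.card = 0 then fun _ => monomial m₀ 1 else 0 with hf
  have hf0 : ∀ τ, τ.card ≠ 0 → f τ = 0 := fun τ hτ => if_neg hτ
  obtain ⟨g, hgI, -, hg⟩ := hv f
    (fun τ => by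
      simp only [hf]; split_ifs
      · exact hmem
      · exact Submodule.zero_mem _) hf0
    (fun τ => by
      simp only [hf]; split_ifs with h
      · intro _ m hm
        rw [Finset.mem_singleton.1 (support_monomial_subset hm), h, hm₀, map_nsmul,
          setExp_degree]
        push_cast
        simp
      · exact isVecForm_zero _ _)
    (koszulBdry_eq_zero_of_support hf0)
  have h1 := koszulBdry_map (LinearMap.proj (R := MvPolynomial V K)
        (φ := fun _ => MvPolynomial V K) ()) g
  rw [hg] at h1
  have h2 : coeff m₀ (koszulBdry (K := K) (fun τ => g τ ()) ∅) = 1 := by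
    have h3 := congrArg (coeff m₀) (congrFun h1 ∅)
    refine h3.trans ?_
    simp [hf]
  rw [coeff_koszulBdry] at h2
  obtain ⟨x, -, hx⟩ := Finset.exists_ne_zero_of_sum_ne_zero (h2 ▸ one_ne_zero)
  split_ifs at hx with hxs
  · have hcoeff : coeff (m₀ - Finsupp.single x 1) (g (insert x ∅) ()) ≠ 0 :=
      fun h => hx (by rw [h, smul_zero])
    have hP := SimpleGraph.mem_symbolicPower_coverIdeal.1 (hgI (insert x ∅)) _
      (mem_support_iff.2 hcoeff)
    rw [Finsupp.mem_support_iff, hval] at hxs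
    have hxC : x ∈ C := by
      by_contra h
      exact hxs (if_neg h)
    have hw : ∃ w, G.Adj x w ∧ w ∉ C := by
      by_contra hcon
      push Not at hcon
      have hcov : G.IsVertexCover ((C.erase x : Finset V) : Set V) := by
        intro y z e
        have hyz := e.ne
        simp only [Finset.coe_erase, Set.mem_sdiff, Finset.mem_coe, Set.mem_singleton_iff]
        by_cases h1 : y = x
        · subst h1
          exact Or.inr ⟨hcon z e, hyz.symm⟩
        · by_cases h2 : z = x
          · subst h2
            exact Or.inl ⟨hcon y e.symm, h1⟩
          · exact (hC.1 e).imp (fun h => ⟨h, h1⟩) (fun h => ⟨h, h2⟩)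
      exact Finset.notMem_erase x C (hC.2 hcov (Finset.erase_subset _ _) hxC)
    obtain ⟨w, hxw, hwC⟩ := hw
    have := hP x w hxw
    simp only [Finsupp.coe_tsub, Pi.sub_apply, hval, if_pos hxC, if_neg hwC,
      Finsupp.single_eq_same] at this
    omega
  · exact hx (smul_zero _)

end CoverIdealRegularity

theorem theorem3p6 {V : Type u} [Fintype V] [Nonempty V] (K : Type v) [Field K]
    (G : SimpleGraph V) (hG : G.IsUnmixed) (k : ℕ) (hk : 1 ≤ k) :
    ∃ r : ℤ, HasRegularity (symbolicPower (G.coverIdeal K) k) r ∧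
      (k : ℤ) * (idealDeg (G.coverIdeal K) : ℤ) ≤ r ∧
      r ≤ ((k : ℤ) - 1) * (idealDeg (G.coverIdeal K) : ℤ) + (Fintype.card V : ℤ) - 1 := by
  -- An arbitrary order on the vertices, serving only to fix the Koszul signs.
  let _ : LinearOrder V := LinearOrder.lift' (Fintype.equivFin V) (Fintype.equivFin V).injective
  obtain ⟨C, -, hC⟩ := G.exists_isMinimalVertexCover_subset (C := Finset.univ) (by simp)
  rw [hG.idealDeg_coverIdeal hC]
  have had : Fintype.card V - C.card + C.card = Fintype.card V :=
    Nat.sub_add_cancel (Finset.card_le_univ C)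
  have hα : ∀ M : Finset V, Maximal G.Indep M → M.card = Fintype.card V - C.card := by
    intro M hM
    have h1 := hG _ _ (SimpleGraph.Indep.isMinimalVertexCover_compl hM) hC
    rw [Finset.card_compl] at h1
    have h2 := Finset.card_le_univ M
    omega
  have hbound : ∀ r, (∃ (i : ℕ) (e : ℤ), ¬ KoszulVanishes
      (symbolicPower (G.coverIdeal K) k).toRankOne (fun _ => 0) i e ∧ r = e - i) →
      r ≤ ((k : ℤ) - 1) * (C.card : ℤ) + (Fintype.card V : ℤ) - 1 := by
    rintro _ ⟨i, e, h, rfl⟩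
    by_contra hlt
    exact h (SimpleGraph.koszulVanishes_symbolicPower_coverIdeal had hα hk (not_le.1 hlt))
  have hmem : ∃ (i : ℕ) (e : ℤ), ¬ KoszulVanishes
      (symbolicPower (G.coverIdeal K) k).toRankOne (fun _ => 0) i e ∧
        (k : ℤ) * (C.card : ℤ) = e - i :=
    ⟨0, _, SimpleGraph.not_koszulVanishes_symbolicPower_coverIdeal hC k hk, by simp⟩
  -- The set of values e - i with nonzero Koszul homology is nonempty and bounded above, and it does
  -- not involve a resolution, so its maximum serves every minimal resolution.
  obtain ⟨r, hr, hmax⟩ := Int.exists_greatest_of_bdd ⟨_, hbound⟩ ⟨_, hmem⟩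
  refine ⟨r, ⟨exists_isMinimal_gradedFreeResolution fun e p hp =>
    G.formComp_mem_symbolicPower_coverIdeal k e hp, fun F hF => ?_⟩, hmax _ hmem, hbound r hr⟩
  rw [hF.regSet_eq]
  exact ⟨hr, fun z hz => hmax z hz⟩
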